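/- Let $F$ be a field. A category is *$F$-linear* if its Hom-sets are $F$-vector spaces and composition is $F$-bilinear. An $F$-linear abelian category is *$F$-finite* if all its objects have finite length and the endomorphism algebra of each object is finite-dimensional over $F$. Let $\mathcal{A}$ be an $F$-finite $F$-linear abelian category and let $F'/F$ be a field extension. Let $\mathrm{Ind}(\mathcal{A})$ be the $F$-linear abelian category of ind-objects of $\mathcal{A}$, let $\mathrm{Ind}(\mathcal{A})_{F'}$ be the $F'$-linear category of *$F'$-modules* in it, i.e. pairs $(X,\phi)$ of an ind-object $X$ and an $F$-algebra homomorphism $\phi:F'\to\mathrm{End}(X)$, with the morphisms $X\to Y$ that commute with the actions of $F'$, and let $\mathcal{A}\otimes_F F'$ be its full subcategory of $F'$-modules of finite length. For an object $X$ of $\mathcal{A}$ let $t(X)=F'\otimes_F X$ be the ind-object representing the functor $Y\mapsto \mathrm{Hom}_F(F',\mathrm{Hom}_{\mathrm{Ind}(\mathcal{A})}(X,Y))$ (a direct sum of $[F':F]$ copies of $X$), with $F'$ acting by multiplication on the first factor. Then: (a) $\mathcal{A}\otimes_F F'$ is an $F'$-finite $F'$-linear abelian category. (b) For every object $X$ of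 $\mathcal{A}$ the $F'$-module $t(X)$ has finite length, and the resulting functor $t:\mathcal{A}\to\mathcal{A}\otimes_F F'$ is $F$-linear, exact and *$F'/F$-fully faithful*: for all objects $X,Y$ of $\mathcal{A}$ the $F'$-linear map $$F'\otimes_F\mathrm{Hom}_{\mathcal{A}}(X,Y)\to\mathrm{Hom}_{\mathcal{A}\otimes_F F'}(t(X),t(Y)),\qquad f'\otimes h\mapsto f'\cdot t(h),$$ is an isomorphism. -/

import Mathlib

open CategoryTheory CategoryTheory.Limits
open scoped TensorProduct

universe w v u v₁ u₁

noncomputable section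

namespace ScalarExt

/-! ### Finite length, `F`-finite categories, relatively fully faithful functors -/

/-- Objects of finite length: those that admit a finite filtration, starting at zero, whose
successive quotients are simple. -/
inductive HasFiniteLength {C : Type u} [Category.{v} C] [Preadditive C] : C → Prop
  | zero (X : C) (hX : IsZero X) : HasFiniteLength X
  | extend (S : ShortComplex C) (hS : S.ShortExact) (h₁ : HasFiniteLength S.X₁)
      (h₃ : Simple S.X₃) : HasFiniteLength S.X₂

/-- A preadditive category is abelian, for its given addition of morphisms. -/
def IsAbelian (C : Type u) [Category.{v} C] [inst : Preadditive C] : Prop :=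
  ∃ h : Abelian C, h.toPreadditive = inst

/-- An `F`-linear category (abelian, in all applications) is `F`-finite if all its objects have
finite length and all its endomorphism algebras are finite-dimensional over `F`. -/
structure IsFFinite (F : Type w) [Field F] (C : Type u) [Category.{v} C] [Preadditive C]
    [Linear F C] : Prop where
  hasFiniteLength : ∀ X : C, HasFiniteLength X
  finite_end : ∀ X : C, Module.Finite F (End X)

section RelativelyFullyFaithful

variable (F : Type*) (F' : Type*) [Field F] [Field F'] [Algebra F F']
  {C : Type u} [Category.{v} C] [Preadditive C] [Linear F C]
  {D : Type u₁} [Category.{v₁} D] [Preadditive D] [Linear F D] [Linear F' D]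
  [∀ X Y : D, IsScalarTower F F' (X ⟶ Y)]

/-- The comparison map `F' ⊗ Hom(X, Y) → Hom(V X, V Y)`, `a ⊗ h ↦ a • V h`. -/
def relativeMap (V : C ⥤ D) [V.Additive] [V.Linear F] (X Y : C) :
    (F' ⊗[F] (X ⟶ Y)) →ₗ[F'] (V.obj X ⟶ V.obj Y) :=
  TensorProduct.AlgebraTensorModule.lift
    ((LinearMap.toSpanSingleton F' ((X ⟶ Y) →ₗ[F] (V.obj X ⟶ V.obj Y)) (V.mapLinearMap F)))

lemma relativeMap_tmul (V : C ⥤ D) [V.Additive] [V.Linear F] (X Y : C) (a : F') (h : X ⟶ Y) :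
    relativeMap F F' V X Y (a ⊗ₜ h) = a • V.map h := rfl

/-- `V` is `F'/F`-fully faithful if all comparison maps are isomorphisms. -/
def IsRelativelyFullyFaithful (V : C ⥤ D) [V.Additive] [V.Linear F] : Prop :=
  ∀ X Y : C, Function.Bijective (relativeMap F F' V X Y)

end RelativelyFullyFaithful

/-! ### `F'`-modules in an `F`-linear category -/

section FieldModule

variable (F : Type*) (F' : Type*) [Field F] [Field F'] [Algebra F F']
  (C : Type u) [Category.{v} C] [Preadditive C] [Linear F C]

/-- An `F'`-module in the `F`-linear category `C`: an object with an `F`-linear ring homomorphism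
from `F'` to its endomorphism algebra. -/
structure FieldModule where
  obj : C
  action : F' →ₐ[F] End obj

namespace FieldModule

variable {F F' C}

/-- The action of a scalar, as a morphism. -/
abbrev act (X : FieldModule F F' C) (a : F') : X.obj ⟶ X.obj := X.action a

@[simp] lemma act_one (X : FieldModule F F' C) : X.act 1 = 𝟙 X.obj := map_one X.action
@[simp] lemma act_zero (X : FieldModule F F' C) : X.act 0 = 0 := map_zero X.action
lemma act_add (X : FieldModule F F' C) (a b : F') : X.act (a + b) = X.act a + X.act b :=
  map_add X.action a b
lemma act_mul (X : FieldModule F F' C) (a b : F') : X.act (a * b) = X.act a ≫ X.act b := by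
  rw [mul_comm]; exact map_mul X.action b a
lemma act_algebraMap (X : FieldModule F F' C) (r : F) :
    X.act (algebraMap F F' r) = r • 𝟙 X.obj :=
  (X.action.commutes r).trans (Algebra.algebraMap_eq_smul_one r)

/-- A homomorphism of `F'`-modules: a morphism commuting with the actions of `F'`. -/
@[ext]
structure Hom (X Y : FieldModule F F' C) where
  hom : X.obj ⟶ Y.obj
  comm : ∀ a : F', X.act a ≫ hom = hom ≫ Y.act a

instance : Category (FieldModule F F' C) where
  Hom X Y := Hom X Y
  id X := ⟨𝟙 X.obj, fun a => by simp⟩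
  comp f g := ⟨f.hom ≫ g.hom, fun a => by
    rw [← Category.assoc, f.comm, Category.assoc, g.comm, Category.assoc]⟩

@[ext] lemma hom_ext {X Y : FieldModule F F' C} {f g : X ⟶ Y} (h : f.hom = g.hom) : f = g :=
  Hom.ext h

@[simp] lemma id_hom (X : FieldModule F F' C) : Hom.hom (𝟙 X) = 𝟙 X.obj := rfl
@[simp] lemma comp_hom {X Y Z : FieldModule F F' C} (f : X ⟶ Y) (g : Y ⟶ Z) :
    (f ≫ g).hom = f.hom ≫ g.hom := rfl

variable {X Y : FieldModule F F' C}

instance : Zero (X ⟶ Y) := ⟨⟨0, fun a => by simp⟩⟩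
instance : Add (X ⟶ Y) := ⟨fun f g => ⟨f.hom + g.hom, fun a => by
  simp [f.comm, g.comm]⟩⟩
instance : Neg (X ⟶ Y) := ⟨fun f => ⟨-f.hom, fun a => by simp [f.comm]⟩⟩
instance : Sub (X ⟶ Y) := ⟨fun f g => ⟨f.hom - g.hom, fun a => by simp [f.comm, g.comm]⟩⟩
instance : SMul ℕ (X ⟶ Y) := ⟨fun n f => ⟨n • f.hom, fun a => by simp [f.comm]⟩⟩
instance : SMul ℤ (X ⟶ Y) := ⟨fun n f => ⟨n • f.hom, fun a => by simp [f.comm]⟩⟩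

@[simp] lemma zero_hom : (0 : X ⟶ Y).hom = 0 := rfl
@[simp] lemma add_hom (f g : X ⟶ Y) : (f + g).hom = f.hom + g.hom := rfl

lemma hom_injective : Function.Injective (fun f : X ⟶ Y => f.hom) := fun _ _ h => hom_ext h

instance : AddCommGroup (X ⟶ Y) :=
  hom_injective.addCommGroup _ rfl (fun _ _ => rfl) (fun _ => rfl) (fun _ _ => rfl)
    (fun _ _ => rfl) (fun _ _ => rfl)

instance : Preadditive (FieldModule F F' C) where
  homGroup _ _ := inferInstance
  add_comp _ _ _ _ _ _ := by ext; simp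
  comp_add _ _ _ _ _ _ := by ext; simp

/-- Scalars in `F` act on homomorphisms through the linear structure of `C`. -/
instance linearBase : Linear F (FieldModule F F' C) where
  homModule X Y :=
    { smul := fun r f => ⟨r • f.hom, fun a => by simp [f.comm]⟩
      one_smul := fun f => hom_ext (one_smul F f.hom)
      mul_smul := fun r s f => hom_ext (mul_smul r s f.hom)
      smul_zero := fun r => hom_ext (smul_zero r)
      smul_add := fun r f g => hom_ext (smul_add r f.hom g.hom)
      add_smul := fun r s f => hom_ext (add_smul r s f.hom)
      zero_smul := fun f => hom_ext (zero_smul F f.hom) }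
  smul_comp _ _ _ r f g := hom_ext (Linear.smul_comp _ _ _ r f.hom g.hom)
  comp_smul _ _ _ f r g := hom_ext (Linear.comp_smul _ _ _ f.hom r g.hom)

/-- Scalars in `F'` act on homomorphisms through the actions of `F'`. -/
instance linearExt : Linear F' (FieldModule F F' C) where
  homModule X Y :=
    { smul := fun a f => ⟨X.act a ≫ f.hom, fun b => by
        rw [← Category.assoc, ← act_mul, mul_comm, act_mul, Category.assoc, f.comm,
          Category.assoc]⟩
      one_smul := fun f => hom_ext (by change X.act 1 ≫ f.hom = f.hom; simp)
      mul_smul := fun a b f => hom_ext (by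
        change X.act (a * b) ≫ f.hom = X.act a ≫ X.act b ≫ f.hom
        rw [act_mul, Category.assoc])
      smul_zero := fun a => hom_ext (by change X.act a ≫ (0 : X.obj ⟶ Y.obj) = 0; simp)
      smul_add := fun a f g => hom_ext (by
        change X.act a ≫ (f.hom + g.hom) = X.act a ≫ f.hom + X.act a ≫ g.hom; simp)
      add_smul := fun a b f => hom_ext (by
        change X.act (a + b) ≫ f.hom = X.act a ≫ f.hom + X.act b ≫ f.hom
        rw [act_add, Preadditive.add_comp])
      zero_smul := fun f => hom_ext (by change X.act 0 ≫ f.hom = 0; simp) }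
  smul_comp _ _ _ a f g := hom_ext (Category.assoc _ _ _)
  comp_smul X Y Z f a g := hom_ext (by
    change f.hom ≫ Y.act a ≫ g.hom = X.act a ≫ f.hom ≫ g.hom
    rw [← Category.assoc, ← f.comm, Category.assoc])

@[simp] lemma smul_hom_base (r : F) (f : X ⟶ Y) : (r • f).hom = r • f.hom := rfl
lemma smul_hom_ext (a : F') (f : X ⟶ Y) : (a • f).hom = X.act a ≫ f.hom := rfl

instance (X Y : FieldModule F F' C) : IsScalarTower F F' (X ⟶ Y) :=
  IsScalarTower.of_algebraMap_smul fun r f => hom_ext (by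
    change X.act (algebraMap F F' r) ≫ f.hom = r • f.hom
    rw [act_algebraMap]; simp)

end FieldModule

end FieldModule

/-! ### External tensor products and the functor `t` -/

section ExternalTensor

variable (F : Type*) [Field F] {C : Type u} [Category.{v} C] [Preadditive C] [Linear F C]

/-- An external tensor product of an `F`-vector space `M` with an object `X`: an object
representing the functor `Y ↦ Hom_F(M, Hom(X, Y))`, with universal element `ι`. -/
structure ExternalTensor (M : Type*) [AddCommGroup M] [Module F M] (X : C) where
  obj : C
  ι : M →ₗ[F] (X ⟶ obj)
  desc : ∀ {Y : C}, (M →ₗ[F] (X ⟶ Y)) → (obj ⟶ Y)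
  fac : ∀ {Y : C} (φ : M →ₗ[F] (X ⟶ Y)) (m : M), ι m ≫ desc φ = φ m
  hom_ext : ∀ {Y : C} {f g : obj ⟶ Y}, (∀ m : M, ι m ≫ f = ι m ≫ g) → f = g

namespace ExternalTensor

attribute [simp] fac

variable {F} {M : Type*} [AddCommGroup M] [Module F M] {X Y Z : C}

@[simp] lemma fac_assoc (T : ExternalTensor F M X) (φ : M →ₗ[F] (X ⟶ Y)) (m : M) (g : Y ⟶ Z) :
    T.ι m ≫ T.desc φ ≫ g = φ m ≫ g := by
  rw [← Category.assoc, T.fac]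

/-- Functoriality of the external tensor product in the vector space. -/
def lmap (T : ExternalTensor F M X) (φ : M →ₗ[F] M) : T.obj ⟶ T.obj :=
  T.desc (T.ι ∘ₗ φ)

@[simp] lemma ι_lmap (T : ExternalTensor F M X) (φ : M →ₗ[F] M) (m : M) :
    T.ι m ≫ T.lmap φ = T.ι (φ m) := by
  simp [lmap]

@[simp] lemma ι_lmap_assoc (T : ExternalTensor F M X) (φ : M →ₗ[F] M) (m : M)
    (g : T.obj ⟶ Z) : T.ι m ≫ T.lmap φ ≫ g = T.ι (φ m) ≫ g := by
  rw [← Category.assoc, ι_lmap]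

/-- Functoriality of the external tensor product in the object. -/
def rmap (T : ExternalTensor F M X) (T' : ExternalTensor F M Y) (f : X ⟶ Y) : T.obj ⟶ T'.obj :=
  T.desc (Linear.leftComp F T'.obj f ∘ₗ T'.ι)

@[simp] lemma ι_rmap (T : ExternalTensor F M X) (T' : ExternalTensor F M Y) (f : X ⟶ Y) (m : M) :
    T.ι m ≫ T.rmap T' f = f ≫ T'.ι m := by
  simp [rmap]

@[simp] lemma ι_rmap_assoc (T : ExternalTensor F M X) (T' : ExternalTensor F M Y) (f : X ⟶ Y)
    (m : M) (g : T'.obj ⟶ Z) : T.ι m ≫ T.rmap T' f ≫ g = f ≫ T'.ι m ≫ g := by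
  rw [← Category.assoc, ι_rmap, Category.assoc]

lemma lmap_rmap (T : ExternalTensor F M X) (T' : ExternalTensor F M Y) (f : X ⟶ Y)
    (φ : M →ₗ[F] M) : T.lmap φ ≫ T.rmap T' f = T.rmap T' f ≫ T'.lmap φ :=
  T.hom_ext fun m => by simp

lemma rmap_id (T : ExternalTensor F M X) : T.rmap T (𝟙 X) = 𝟙 T.obj :=
  T.hom_ext fun m => by simp

lemma rmap_comp (T : ExternalTensor F M X) (T' : ExternalTensor F M Y)
    (T'' : ExternalTensor F M Z) (f : X ⟶ Y) (g : Y ⟶ Z) :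
    T.rmap T'' (f ≫ g) = T.rmap T' f ≫ T'.rmap T'' g :=
  T.hom_ext fun m => by simp

end ExternalTensor

/-- The external tensor product, constructed as a direct sum of copies of `X` indexed by a basis
of `M`. -/
def externalTensor [HasCoproducts.{w} C] (M : Type w) [AddCommGroup M] [Module F M] (X : C) :
    ExternalTensor F M X :=
  let b := Module.Basis.ofVectorSpace F M
  { obj := ∐ (fun _ : Module.Basis.ofVectorSpaceIndex F M => X)
    ι := b.constr F (fun i => Sigma.ι (fun _ : Module.Basis.ofVectorSpaceIndex F M => X) i)
    desc := fun φ => Sigma.desc (fun i => φ (b i))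
    fac := fun {Y} φ m => by
      have : (Linear.rightComp F X (Sigma.desc (fun i => φ (b i)))) ∘ₗ
          b.constr F (fun i => Sigma.ι (fun _ : Module.Basis.ofVectorSpaceIndex F M => X) i)
          = φ := by
        refine b.ext fun i => ?_
        simp
      exact LinearMap.congr_fun this m
    hom_ext := fun {Y f g} h => by
      refine Sigma.hom_ext _ _ fun i => ?_
      simpa using h (b i) }

section FreeModule

variable {F}
variable {F' : Type*} [Field F'] [Algebra F F'] {X Y : C}

/-- The `F'`-module structure on `F' ⊗ X` given by multiplication on the first factor. -/
def ExternalTensor.toFieldModule (T : ExternalTensor F F' X) : FieldModule F F' C where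
  obj := T.obj
  action := AlgHom.ofLinearMap
    { toFun := fun a => End.of (T.lmap (LinearMap.mulLeft F a))
      map_add' := fun a b => T.hom_ext fun m => by
        change T.ι m ≫ T.lmap _ = T.ι m ≫ (T.lmap _ + T.lmap _)
        simp [add_mul]
      map_smul' := fun r a => T.hom_ext fun m => by
        change T.ι m ≫ T.lmap _ = T.ι m ≫ (r • T.lmap _)
        simp }
    (T.hom_ext fun m => by
      change T.ι m ≫ T.lmap _ = T.ι m ≫ 𝟙 _
      simp)
    (fun a b => T.hom_ext fun m => by
      change T.ι m ≫ T.lmap _ = T.ι m ≫ T.lmap _ ≫ T.lmap _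
      simp)

lemma ExternalTensor.toFieldModule_act (T : ExternalTensor F F' X) (a : F') :
    T.toFieldModule.act a = T.lmap (LinearMap.mulLeft F a) := rfl

end FreeModule

variable (F' : Type w) [Field F'] [Algebra F F'] [HasCoproducts.{w} C]

/-- The functor `X ↦ F' ⊗ X`, where `F'` acts by multiplication on the first factor. -/
def freeModule : C ⥤ FieldModule F F' C where
  obj X := (externalTensor F F' X).toFieldModule
  map {X Y} f :=
    { hom := (externalTensor F F' X).rmap (externalTensor F F' Y) f
      comm := fun a => ExternalTensor.lmap_rmap (externalTensor F F' X) (externalTensor F F' Y) f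
        (LinearMap.mulLeft F a) }
  map_id X := FieldModule.hom_ext (ExternalTensor.rmap_id (externalTensor F F' X))
  map_comp {X Y Z} f g := FieldModule.hom_ext (ExternalTensor.rmap_comp (externalTensor F F' X)
    (externalTensor F F' Y) (externalTensor F F' Z) f g)

end ExternalTensor

/-! ### The linear structure on the category of ind-objects -/

section IndLinear

section

variable {F : Type*} [Field F] {B : Type u} [Category.{v} B] [Preadditive B] [Linear F B]

/-- The scalar `r` acts on a presheaf `P` through `P(r • 𝟙 U) : P(U) → P(U)`. -/
def presheafScalar (r : F) (P : Bᵒᵖ ⥤ Type v) : P ⟶ P where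
  app U := P.map (r • 𝟙 U.unop).op
  naturality U V f := by
    rw [← Functor.map_comp, ← Functor.map_comp]
    congr 1
    apply Quiver.Hom.unop_inj
    simp

lemma presheafScalar_naturality (r : F) {P Q : Bᵒᵖ ⥤ Type v} (f : P ⟶ Q) :
    f ≫ presheafScalar r Q = presheafScalar r P ≫ f := by
  ext U : 2
  exact (f.naturality _).symm

lemma presheafScalar_yoneda (r : F) (U : B) :
    presheafScalar r (yoneda.obj U) = yoneda.map (r • 𝟙 U) := by
  ext V g
  simp [presheafScalar]

/-- The scalar `r` acts on an ind-object through its action on the underlying presheaf. -/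
def indScalar (r : F) (X : Ind B) : X ⟶ X :=
  (Ind.inclusion.fullyFaithful (C := B)).preimage (presheafScalar r ((Ind.inclusion B).obj X))

lemma inclusion_map_indScalar (r : F) (X : Ind B) :
    (Ind.inclusion B).map (indScalar r X) = presheafScalar r _ :=
  Functor.FullyFaithful.map_preimage _ _

lemma indScalar_naturality (r : F) {X Y : Ind B} (f : X ⟶ Y) :
    f ≫ indScalar r Y = indScalar r X ≫ f := by
  apply (Ind.inclusion B).map_injective
  rw [Functor.map_comp, Functor.map_comp, inclusion_map_indScalar, inclusion_map_indScalar,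
    presheafScalar_naturality]

lemma indScalar_yoneda (r : F) (U : B) :
    indScalar r (Ind.yoneda.obj U) = Ind.yoneda.map (r • 𝟙 U) := by
  apply (Ind.inclusion B).map_injective
  rw [inclusion_map_indScalar]
  have h := Ind.yonedaCompInclusion.hom.naturality (r • 𝟙 U)
  rw [← presheafScalar_yoneda, presheafScalar_naturality] at h
  exact ((cancel_mono (Ind.yonedaCompInclusion.hom.app U)).1 h).symm

end

variable (F : Type*) [Field F] (B : Type u) [SmallCategory B] [Preadditive B]
  [HasFiniteColimits B] [Linear F B]

instance : (Ind.yoneda (C := B)).Additive := by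
  have : HasFiniteBiproducts B := HasFiniteBiproducts.of_hasFiniteCoproducts
  have : HasBinaryBiproducts B := hasBinaryBiproducts_of_finite_biproducts B
  have : PreservesBinaryBiproducts (Ind.yoneda (C := B)) :=
    preservesBinaryBiproducts_of_preservesBinaryCoproducts _
  exact Functor.additive_of_preservesBinaryBiproducts _

lemma ind_hom_ext {B : Type u} [SmallCategory B] {X Y : Ind B} {f g : X ⟶ Y}
    (h : ∀ (U : B) (x : Ind.yoneda.obj U ⟶ X), x ≫ f = x ≫ g) : f = g :=
  Ind.isSeparating_range_yoneda _ _ fun _ hG x => by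
    obtain ⟨U⟩ := hG
    exact h U x

/-- The action of `F` on the identity functor of `Ind B`. -/
def indScalarHom : F →+* CatCenter (Ind B) where
  toFun r := { app := fun X => indScalar r X, naturality := fun _ _ f => indScalar_naturality r f }
  map_one' := by
    ext X
    refine ind_hom_ext fun U x => ?_
    change x ≫ indScalar _ _ = x ≫ 𝟙 X
    rw [indScalar_naturality, indScalar_yoneda]
    simp
  map_zero' := by
    ext X
    refine ind_hom_ext fun U x => ?_
    change x ≫ indScalar _ _ = x ≫ 0
    rw [indScalar_naturality, indScalar_yoneda]
    simp
  map_add' r s := by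
    ext X
    refine ind_hom_ext fun U x => ?_
    change x ≫ indScalar (r + s) X = x ≫ (indScalar r X + indScalar s X)
    rw [Preadditive.comp_add, indScalar_naturality, indScalar_naturality, indScalar_naturality,
      indScalar_yoneda, indScalar_yoneda, indScalar_yoneda, add_smul, Functor.map_add,
      Preadditive.add_comp]
  map_mul' r s := by
    ext X
    refine ind_hom_ext fun U x => ?_
    change x ≫ indScalar (r * s) X = x ≫ indScalar s X ≫ indScalar r X
    have h : indScalar (r * s) (Ind.yoneda.obj U) =
        indScalar s (Ind.yoneda.obj U) ≫ indScalar r (Ind.yoneda.obj U) := by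
      rw [indScalar_yoneda, indScalar_yoneda, indScalar_yoneda, ← Functor.map_comp]
      simp [mul_smul]
    rw [indScalar_naturality, h, Category.assoc, ← indScalar_naturality r x,
      ← Category.assoc, ← indScalar_naturality s x, Category.assoc]

/-- The `F`-linear structure on `Ind B`. -/
instance indLinear : Linear F (Ind B) := Linear.ofRingMorphism (indScalarHom F B)

instance : (Ind.yoneda (C := B)).Linear F where
  map_smul {X Y} f r := by
    change _ = indScalar r _ ≫ _
    rw [indScalar_yoneda, ← Functor.map_comp]
    simp

end IndLinear

/-! ### The scalar extension of an `F`-linear abelian category -/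

section

variable (F : Type*) [Field F] (A : Type u) [Category.{v} A] [Preadditive A] [Linear F A]

lemma comp_smul_id {X Y : A} (r : F) (f : X ⟶ Y) : f ≫ (r • 𝟙 Y) = (r • 𝟙 X) ≫ f := by simp

lemma mul_smul_id (r s : F) (X : A) : (r * s) • 𝟙 X = (s • 𝟙 X) ≫ (r • 𝟙 X) := by
  simp [mul_smul]

/-- The `F`-linear structure on the small model `AsSmall A` of `A`. -/
instance asSmallLinear : Linear F (AsSmall.{w} A) := Linear.ofRingMorphism
  { toFun := fun r =>
      { app := fun X => AsSmall.up.map (r • 𝟙 (AsSmall.down.obj X))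
        naturality := fun X Y f => congrArg ULift.up (comp_smul_id F A r f.down) }
    map_one' := by
      ext X
      exact congrArg AsSmall.up.map (one_smul F (𝟙 (AsSmall.down.obj X)))
    map_zero' := by
      ext X
      exact (congrArg AsSmall.up.map (zero_smul F (𝟙 (AsSmall.down.obj X)))).trans (Functor.map_zero _ _ _)
    map_add' := fun r s => by
      ext X
      exact (congrArg AsSmall.up.map (add_smul r s (𝟙 (AsSmall.down.obj X)))).trans (Functor.map_add _)
    map_mul' := fun r s => by
      ext X
      exact congrArg ULift.up (mul_smul_id F A r s (AsSmall.down.obj X)) }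

lemma asSmall_up_smul {X Y : A} (r : F) (f : X ⟶ Y) :
    (AsSmall.up (C := A) : A ⥤ AsSmall.{w} A).map (r • f) = r • AsSmall.up.map f := by
  change _ = AsSmall.up.map (r • 𝟙 X) ≫ AsSmall.up.map f
  rw [← Functor.map_comp]
  simp

instance : (AsSmall.up (C := A) : A ⥤ AsSmall.{w} A).Linear F where
  map_smul f r := asSmall_up_smul F A r f

end

section

variable (F : Type*) [Field F] (F' : Type w) [Field F'] [Algebra F F']
  (A : Type u) [Category.{v} A] [Abelian A] [Linear F A]

/-- The category of ind-objects of `A`. The universe is enlarged so that `A` is small and direct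
sums indexed by elements of `Type w` exist in `Ind A`. -/
abbrev IndCat : Type _ := Ind (AsSmall.{w} A)

/-- The embedding of `A` into `Ind A`. -/
abbrev toIndCat : A ⥤ IndCat.{w} A := AsSmall.up ⋙ Ind.yoneda

instance : HasCoproducts.{w} (IndCat.{w} A) := hasCoproducts_shrink.{w, max w u v}

/-- The category of `F'`-modules in `Ind A`. -/
abbrev IndModule : Type _ := FieldModule F F' (IndCat.{w} A)

/-- The functor `t`, from `A` to `F'`-modules in `Ind A`. -/
abbrev tInd : A ⥤ IndModule F F' A := toIndCat.{w} A ⋙ freeModule F F'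

instance {C : Type u} [Category.{v} C] [Preadditive C] [Linear F C] [Linear F' C]
    [∀ X Y : C, IsScalarTower F F' (X ⟶ Y)] (P : ObjectProperty C) (X Y : P.FullSubcategory) :
    IsScalarTower F F' (X ⟶ Y) :=
  IsScalarTower.of_algebraMap_smul fun r f =>
    P.hom_ext (algebraMap_smul F' r f.hom)

/-- The property of `F'`-modules in `Ind A` of having finite length. -/
def finiteLength : ObjectProperty (IndModule F F' A) := fun X => HasFiniteLength X

/-- The scalar extension `A ⊗_F F'`: the full subcategory of `F'`-modules of finite length in
`Ind A`. -/
abbrev ScalarExtension : Type _ := (finiteLength F F' A).FullSubcategory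

end

end ScalarExt
end

/-!
Write `C` for the category of ind-objects of `A`, and `t X` for the free `F'`-module on an object
`X` of `A`. The facts about `C` that matter are that morphisms from objects of `A` separate
morphisms, and that a morphism from an object of `A` to a direct sum of copies of an object `Y` of
`A` is a finite sum of morphisms into the summands (`isCompactlySeparating_toIndCat`); the second
holds since a direct sum is the filtered colimit of its finite subsums and objects of `A` are
finitely presented in `C`.

Modules in an abelian category form an abelian category, with the kernels and cokernels of the
underlying objects (`fieldModuleAbelian`), and objects of finite length form a Serre class
(`isSerreClass_hasFiniteLength`). So the modules of finite length form an abelian category.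

By adjunction, `Hom(t X, t Y) = Hom_C(X, F' ⊗ Y)`, and in terms of a basis of `F'` the right-hand
side consists of the finitely supported families of morphisms `X ⟶ Y`. This is the relative full
faithfulness of `t` (`isRelativelyFullyFaithful_free`). As a left adjoint `t` is right exact, and it
preserves monomorphisms because these can be tested on finite sums of components
(`preservesFiniteLimits_free`).

The finiteness statements rest on semisimplicity: for a simple object `S` of `A`, every quotient of
a direct sum of copies of `S` splits (`IsCompactlySeparating.exists_section`). Indeed the components
of the quotient map span a vector space over the division ring `End S`, and those that belong to a
basis of it already give an isomorphism from a smaller direct sum. Consequently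

* a submodule `N` of `t S` is determined by the subspace `Hom(t S, N)` of `Hom(t S, t S)`, which is
  finite-dimensional over `F'`; so `t S` has finite length (`hasFiniteLength_free_of_simple`), and
  so has every `t X`, by exactness;
* every simple module `N` is a quotient of `t S` for some simple `S`, and homomorphisms `t X ⟶ N`
  lift to `t S`, so that they form a finite-dimensional space; by dévissage the same holds for
  homomorphisms between any modules of finite length (`finite_hom_of_hasFiniteLength`).
-/

noncomputable section

namespace ScalarExt

/-! ### Objects of finite length in an abelian category -/

section FiniteLength

variable {C : Type u} [Category.{v} C] [Abelian C]

lemma HasFiniteLength.of_iso {X Y : C} (hX : HasFiniteLength X) (e : X ≅ Y) :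
    HasFiniteLength Y := by
  induction hX with
  | zero X hX => exact .zero Y (hX.of_iso e.symm)
  | extend S hS h₁ h₃ _ =>
    have := hS.mono_f
    have := hS.epi_g
    have e' : S ≅ ShortComplex.mk (S.f ≫ e.hom) (e.inv ≫ S.g) (by simp) :=
      ShortComplex.isoMk (Iso.refl _) e (Iso.refl _)
    exact .extend _ (ShortComplex.shortExact_of_iso e' hS) h₁ h₃

lemma shortExact_kernel {X Y : C} (f : X ⟶ Y) [Epi f] :
    (ShortComplex.mk (kernel.ι f) f (kernel.condition f)).ShortExact :=
  { exact := ShortComplex.exact_kernel f }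

lemma shortExact_cokernel {X Y : C} (f : X ⟶ Y) [Mono f] :
    (ShortComplex.mk f (cokernel.π f) (cokernel.condition f)).ShortExact :=
  { exact := ShortComplex.exact_cokernel f }

/-- Subobjects have finite length: the intersection with the penultimate step of a filtration has a
quotient that embeds into a simple object. -/
lemma HasFiniteLength.of_mono {X : C} (hX : HasFiniteLength X) :
    ∀ {Y : C} (i : Y ⟶ X) [Mono i], HasFiniteLength Y := by
  induction hX with
  | zero X hX => exact fun i _ => .zero _ (IsZero.of_mono i hX)
  | extend S hS h₁ h₃ ih =>
    intro Y i _
    have := hS.mono_f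
    by_cases h : i ≫ S.g = 0
    · have : Mono (hS.exact.lift i h ≫ S.f) := by rw [hS.exact.lift_f]; infer_instance
      have : Mono (hS.exact.lift i h) := mono_of_mono _ S.f
      exact ih (hS.exact.lift i h)
    · have : Epi (i ≫ S.g) := epi_of_nonzero_to_simple h
      have hk : (kernel.ι (i ≫ S.g) ≫ i) ≫ S.g = 0 := by
        rw [Category.assoc, kernel.condition]
      have : Mono (hS.exact.lift _ hk ≫ S.f) := by rw [hS.exact.lift_f]; infer_instance
      have : Mono (hS.exact.lift _ hk) := mono_of_mono _ S.f
      exact .extend _ (shortExact_kernel (i ≫ S.g)) (ih (hS.exact.lift _ hk)) h₃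

/-- Quotients have finite length: the image of the penultimate step of a filtration has a cokernel
that is a quotient of a simple object. -/
lemma HasFiniteLength.of_epi {X : C} (hX : HasFiniteLength X) :
    ∀ {Y : C} (p : X ⟶ Y) [Epi p], HasFiniteLength Y := by
  induction hX with
  | zero X hX => exact fun p _ => .zero _ (IsZero.of_epi p hX)
  | extend S hS h₁ h₃ ih =>
    intro Y p _
    have := hS.epi_g
    have hI : HasFiniteLength (Abelian.image (S.f ≫ p)) :=
      ih (Abelian.factorThruImage (S.f ≫ p))
    have hc : S.f ≫ p ≫ cokernel.π (S.f ≫ p) = 0 := by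
      rw [← Category.assoc, cokernel.condition]
    have hd : S.g ≫ hS.exact.desc _ hc = p ≫ cokernel.π (S.f ≫ p) := hS.exact.g_desc _ hc
    have : Epi (S.g ≫ hS.exact.desc _ hc) := by rw [hd]; infer_instance
    have : Epi (hS.exact.desc _ hc) := epi_of_epi S.g _
    by_cases h : hS.exact.desc _ hc = 0
    · have h0 : cokernel.π (S.f ≫ p) = 0 := by
        rw [← cancel_epi p, comp_zero, ← hd, h, comp_zero]
      have : Epi (S.f ≫ p) := Preadditive.epi_of_cokernel_zero h0
      exact ih (S.f ≫ p)
    · have : IsIso (hS.exact.desc _ hc) := isIso_of_epi_of_nonzero h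
      exact .extend _ (shortExact_kernel (cokernel.π (S.f ≫ p))) hI
        (Simple.of_iso (asIso (hS.exact.desc _ hc)).symm)

/-- Finite length passes from the kernel and the target of an epimorphism to its source. -/
lemma HasFiniteLength.of_epi_kernel {N : C} (hN : HasFiniteLength N) :
    ∀ {X : C} (g : X ⟶ N) [Epi g], HasFiniteLength (kernel g) → HasFiniteLength X := by
  induction hN with
  | zero N hN =>
    intro X g _ h
    obtain rfl : g = 0 := hN.eq_of_tgt _ _
    exact h.of_epi (kernel.ι (0 : X ⟶ N))
  | extend S hS h₁ h₃ ih =>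
    intro X g _ h
    have := hS.epi_g
    have := hS.mono_f
    -- the preimage of `S.X₁` in `X` surjects onto `S.X₁` with the kernel of `g` as its kernel
    let p := pullback.snd g S.f
    have hp : HasFiniteLength (kernel p) := by
      have w : (kernel.ι p ≫ pullback.fst g S.f) ≫ g = 0 := by
        rw [Category.assoc, pullback.condition, kernel.condition_assoc, zero_comp]
      have : Mono (kernel.lift g _ w ≫ kernel.ι g) := by
        rw [kernel.lift_ι]; infer_instance
      have : Mono (kernel.lift g _ w) := mono_of_mono _ (kernel.ι g)
      exact h.of_mono (kernel.lift g _ w)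
    refine .extend (ShortComplex.mk (pullback.fst g S.f) (g ≫ S.g) (by
      rw [← Category.assoc, pullback.condition, Category.assoc, S.zero, comp_zero])) ?_
      (ih p hp) h₃
    refine { exact := ?_, mono_f := inferInstance, epi_g := epi_comp g S.g }
    refine ShortComplex.exact_of_f_is_kernel _ (KernelFork.IsLimit.ofι' _ _ fun {T} k hk => ?_)
    have hk' : (k ≫ g) ≫ S.g = 0 := by simpa using hk
    exact ⟨pullback.lift k (hS.exact.lift _ hk') (by rw [hS.exact.lift_f]),
      pullback.lift_fst _ _ _⟩

lemma HasFiniteLength.of_shortExact {S : ShortComplex C} (hS : S.ShortExact)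
    (h₁ : HasFiniteLength S.X₁) (h₃ : HasFiniteLength S.X₃) : HasFiniteLength S.X₂ := by
  have := hS.epi_g
  have := hS.mono_f
  exact h₃.of_epi_kernel S.g (h₁.of_iso
    (hS.fIsKernel.conePointUniqueUpToIso (limit.isLimit _)))

/-- Objects of finite length form a Serre class. -/
lemma isSerreClass_hasFiniteLength :
    ObjectProperty.IsSerreClass (HasFiniteLength : ObjectProperty C) where
  exists_zero := let ⟨Z, hZ⟩ := HasZeroObject.zero (C := C); ⟨Z, hZ, .zero Z hZ⟩
  prop_of_mono f _ h := h.of_mono f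
  prop_of_epi f _ h := h.of_epi f
  prop_X₂_of_shortExact hS h₁ h₃ := .of_shortExact hS h₁ h₃

/-- A dimension function on objects that strictly increases along proper inclusions between
subobjects of `X` bounds the length of `X`. -/
lemma HasFiniteLength.of_strictMono (d : C → ℕ) (X : C)
    (hd : ∀ {Y Z : C} (j : Y ⟶ Z) (i : Z ⟶ X) [Mono j] [Mono i], ¬ IsIso j → d Y < d Z) :
    HasFiniteLength X := by
  suffices H : ∀ (n : ℕ) {Z : C} (i : Z ⟶ X) [Mono i], d Z = n → HasFiniteLength Z from
    H _ (𝟙 X) rfl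
  intro n
  induction n using Nat.strong_induction_on with
  | _ n ih =>
  intro Z i _ hZ
  by_cases h0 : IsZero Z
  · exact .zero _ h0
  -- a proper subobject `Y` of `Z` of maximal dimension has a simple quotient
  let s : Set ℕ := {m | ∃ (Y : C) (j : Y ⟶ Z), Mono j ∧ ¬ IsIso j ∧ d Y = m}
  have hs : s.Nonempty := by
    refine ⟨_, kernel (𝟙 Z), kernel.ι _, inferInstance, fun h => h0 ?_, rfl⟩
    exact (isZero_kernel_of_mono (𝟙 Z)).of_iso (asIso (kernel.ι (𝟙 Z))).symm
  have hb : BddAbove s := ⟨d Z, by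
    rintro _ ⟨Y, j, _, hj, rfl⟩
    exact (hd j i hj).le⟩
  obtain ⟨Y, j, hj, hj', hY⟩ := Nat.sSup_mem hs hb
  refine .extend _ (shortExact_cokernel j) (ih _ (hZ ▸ hd j i hj') (j ≫ i) rfl) ?_
  refine simple_of_cosimple _ fun {W} f _ => ⟨fun hf h => ?_, fun hf => ?_⟩
  · subst h
    have : IsZero (cokernel j) := by
      rw [IsZero.iff_id_eq_zero, ← cancel_mono (0 : cokernel j ⟶ W)]; simp
    have : Epi j := Preadditive.epi_of_cokernel_zero (this.eq_of_tgt _ _)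
    exact hj' (isIso_of_mono_of_epi j)
  · let l : Y ⟶ kernel (cokernel.π j ≫ f) := kernel.lift _ j (by simp)
    have hl : l ≫ kernel.ι _ = j := kernel.lift_ι _ _ _
    have : Mono (l ≫ kernel.ι (cokernel.π j ≫ f)) := by rw [hl]; exact hj
    have : Mono l := mono_of_mono l (kernel.ι _)
    have hk : ¬ IsIso (kernel.ι (cokernel.π j ≫ f)) := fun h => hf <| by
      have h1 := kernel.condition (cokernel.π j ≫ f)
      rw [← cancel_epi (cokernel.π j), ← cancel_epi (kernel.ι (cokernel.π j ≫ f)), h1]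
      simp
    have hiso : IsIso l := by
      by_contra hl'
      have h1 := hd l (kernel.ι (cokernel.π j ≫ f) ≫ i) hl'
      have h2 : d (kernel (cokernel.π j ≫ f)) ≤ sSup s :=
        le_csSup hb ⟨_, kernel.ι _, inferInstance, hk, rfl⟩
      omega
    have hz : kernel.ι (cokernel.π j ≫ f) ≫ cokernel.π j = 0 := by
      rw [← cancel_epi l, ← Category.assoc, hl, cokernel.condition, comp_zero]
    have h1 : f ≫ Abelian.epiDesc (cokernel.π j ≫ f) _ hz = 𝟙 _ := by
      rw [← cancel_epi (cokernel.π j), ← Category.assoc, Abelian.comp_epiDesc, Category.comp_id]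
    have : Mono (f ≫ Abelian.epiDesc (cokernel.π j ≫ f) _ hz) := by rw [h1]; infer_instance
    have : Mono f := mono_of_mono f (Abelian.epiDesc (cokernel.π j ≫ f) _ hz)
    exact isIso_of_mono_of_epi f

end FiniteLength

/-! ### Finite-dimensional spaces of morphisms -/

section FiniteHom

variable (k : Type*) [Field k] {C : Type u} [Category.{v} C] [Abelian C] [Linear k C]

lemma finite_of_finite_ker {k V W : Type*} [Field k] [AddCommGroup V] [Module k V] [AddCommGroup W]
    [Module k W] (f : V →ₗ[k] W) [Module.Finite k W] (h : Module.Finite k (LinearMap.ker f)) :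
    Module.Finite k V :=
  have := f.quotKerEquivRange.symm.finiteDimensional
  .of_submodule_quotient (LinearMap.ker f)

lemma finite_hom_of_shortExact_right (T : C) {S : ShortComplex C} (hS : S.ShortExact)
    (h₁ : Module.Finite k (T ⟶ S.X₁)) (h₃ : Module.Finite k (T ⟶ S.X₃)) :
    Module.Finite k (T ⟶ S.X₂) := by
  have := hS.mono_f
  have hle : LinearMap.ker (Linear.rightComp k T S.g) ≤
      LinearMap.range (Linear.rightComp k T S.f) :=
    fun x hx => ⟨hS.exact.lift x hx, hS.exact.lift_f x hx⟩
  exact finite_of_finite_ker (Linear.rightComp k T S.g) (Submodule.finiteDimensional_of_le hle)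

lemma finite_hom_of_shortExact_left (T : C) {S : ShortComplex C} (hS : S.ShortExact)
    (h₁ : Module.Finite k (S.X₁ ⟶ T)) (h₃ : Module.Finite k (S.X₃ ⟶ T)) :
    Module.Finite k (S.X₂ ⟶ T) := by
  have := hS.epi_g
  have hle : LinearMap.ker (Linear.leftComp k T S.f) ≤
      LinearMap.range (Linear.leftComp k T S.g) :=
    fun x hx => ⟨hS.exact.desc x hx, hS.exact.g_desc x hx⟩
  exact finite_of_finite_ker (Linear.leftComp k T S.f) (Submodule.finiteDimensional_of_le hle)

lemma finite_hom_of_epi {X Y : C} (p : X ⟶ Y) [Epi p] (T : C) [Module.Finite k (X ⟶ T)] :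
    Module.Finite k (Y ⟶ T) :=
  .of_injective (Linear.leftComp k T p) fun _ _ h => (cancel_epi p).1 h

end FiniteHom


/-! ### The abelian category of `F'`-modules -/

namespace FieldModule

variable {F : Type*} {F' : Type*} [Field F] [Field F'] [Algebra F F']
  {C : Type u} [Category.{v} C] [Preadditive C] [Linear F C]

/-- A family of endomorphisms that behaves like an action of `F'` makes an object an
`F'`-module. -/
def mk' (K : C) (e : F' → (K ⟶ K)) (he : ∀ a b, e (a + b) = e a + e b)
    (hm : ∀ a b, e (a * b) = e b ≫ e a) (hr : ∀ r : F, e (algebraMap F F' r) = r • 𝟙 K) :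
    FieldModule F F' C where
  obj := K
  action := AlgHom.ofLinearMap
    { toFun := fun a => End.of (e a)
      map_add' := he
      map_smul' := fun r a => by
        change e (r • a) = r • e a
        rw [Algebra.smul_def, hm, hr, Linear.comp_smul, Category.comp_id] }
    (by
      change e 1 = 𝟙 K
      rw [← map_one (algebraMap F F'), hr, one_smul])
    hm

/-- A subobject of the underlying object that is stable under the action. -/
def ofMono (X : FieldModule F F' C) {K : C} (i : K ⟶ X.obj) [Mono i] (e : F' → (K ⟶ K))
    (h : ∀ a, e a ≫ i = i ≫ X.act a) : FieldModule F F' C :=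
  mk' K e (fun a b => by simp [← cancel_mono i, h, act_add])
    (fun a b => by
      rw [← cancel_mono i, h, mul_comm, act_mul, Category.assoc, h, ← Category.assoc, ← h,
        Category.assoc])
    (fun r => by rw [← cancel_mono i, h, act_algebraMap]; simp)

/-- A quotient of the underlying object to which the action descends. -/
def ofEpi (X : FieldModule F F' C) {K : C} (p : X.obj ⟶ K) [Epi p] (e : F' → (K ⟶ K))
    (h : ∀ a, p ≫ e a = X.act a ≫ p) : FieldModule F F' C :=
  mk' K e (fun a b => by simp [← cancel_epi p, h, act_add])
    (fun a b => by
      rw [← cancel_epi p, h, mul_comm, act_mul, Category.assoc, ← Category.assoc p, h,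
        Category.assoc, h])
    (fun r => by rw [← cancel_epi p, h, act_algebraMap]; simp)

/-- The underlying object of an `F'`-module. -/
def forget (F F' : Type*) [Field F] [Field F'] [Algebra F F']
    (C : Type u) [Category.{v} C] [Preadditive C] [Linear F C] : FieldModule F F' C ⥤ C where
  obj X := X.obj
  map f := f.hom

variable {X Y : FieldModule F F' C}

lemma isIso_of_isIso_hom (f : X ⟶ Y) [IsIso f.hom] : IsIso f :=
  ⟨⟨⟨inv f.hom, fun a => by
      rw [IsIso.comp_inv_eq, Category.assoc, IsIso.eq_inv_comp, ← f.comm]⟩,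
    hom_ext (by simp), hom_ext (by simp)⟩⟩

section Kernel

variable [HasKernels C]

/-- The kernel of a homomorphism, with the induced action. -/
def kernelObj (f : X ⟶ Y) : FieldModule F F' C :=
  X.ofMono (kernel.ι f.hom)
    (fun a => kernel.lift f.hom (kernel.ι f.hom ≫ X.act a) (by
      rw [Category.assoc, f.comm, kernel.condition_assoc, zero_comp]))
    (fun a => kernel.lift_ι _ _ _)

/-- The inclusion of the kernel. -/
def kernelHom (f : X ⟶ Y) : kernelObj f ⟶ X where
  hom := kernel.ι f.hom
  comm _ := kernel.lift_ι _ _ _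

lemma kernelHom_comp (f : X ⟶ Y) : kernelHom f ≫ f = 0 := hom_ext (kernel.condition f.hom)

/-- A homomorphism that lifts, as a morphism, along a monomorphism lifts as a homomorphism. -/
def liftMono {Z : FieldModule F F' C} (i : X ⟶ Y) [Mono i.hom] (g : Z ⟶ Y) (l : Z.obj ⟶ X.obj)
    (hl : l ≫ i.hom = g.hom) : Z ⟶ X where
  hom := l
  comm a := by
    rw [← cancel_mono i.hom, Category.assoc, hl, g.comm, Category.assoc, i.comm, ← hl,
      Category.assoc]

instance (f : X ⟶ Y) : Mono (kernelHom f).hom := inferInstanceAs (Mono (kernel.ι f.hom))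

/-- `kernelObj f` is the kernel of `f`. -/
def isLimitKernel (f : X ⟶ Y) :
    IsLimit (KernelFork.ofι (kernelHom f) (kernelHom_comp f)) :=
  KernelFork.IsLimit.ofι _ _
    (fun g hg => liftMono (kernelHom f) g
      (kernel.lift f.hom g.hom (congrArg Hom.hom hg)) (kernel.lift_ι _ _ _))
    (fun g hg => hom_ext (kernel.lift_ι _ _ _))
    (fun g hg m hm => hom_ext (by
      rw [← cancel_mono (kernelHom f).hom]
      exact (congrArg Hom.hom hm).trans (kernel.lift_ι _ _ _).symm))

instance : HasKernels (FieldModule F F' C) :=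
  ⟨fun f => ⟨⟨_, isLimitKernel f⟩⟩⟩

lemma mono_hom (f : X ⟶ Y) [Mono f] : Mono f.hom := by
  refine Preadditive.mono_of_kernel_zero ?_
  have h : kernelHom f = 0 := by rw [← cancel_mono f, kernelHom_comp, zero_comp]
  exact congrArg Hom.hom h

end Kernel

section Cokernel

variable [HasCokernels C]

/-- The cokernel of a homomorphism, with the induced action. -/
def cokernelObj (f : X ⟶ Y) : FieldModule F F' C :=
  Y.ofEpi (cokernel.π f.hom)
    (fun a => cokernel.desc f.hom (Y.act a ≫ cokernel.π f.hom) (by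
      rw [← Category.assoc, ← f.comm, Category.assoc, cokernel.condition, comp_zero]))
    (fun a => cokernel.π_desc _ _ _)

/-- The projection to the cokernel. -/
def cokernelHom (f : X ⟶ Y) : Y ⟶ cokernelObj f where
  hom := cokernel.π f.hom
  comm _ := (cokernel.π_desc _ _ _).symm

lemma comp_cokernelHom (f : X ⟶ Y) : f ≫ cokernelHom f = 0 := hom_ext (cokernel.condition f.hom)

/-- A homomorphism that descends, as a morphism, along an epimorphism descends as a
homomorphism. -/
def descEpi {Z : FieldModule F F' C} (p : X ⟶ Y) [Epi p.hom] (g : X ⟶ Z) (l : Y.obj ⟶ Z.obj)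
    (hl : p.hom ≫ l = g.hom) : Y ⟶ Z where
  hom := l
  comm a := by
    rw [← cancel_epi p.hom, ← Category.assoc, ← p.comm, Category.assoc, hl, g.comm,
      ← Category.assoc, hl]

instance (f : X ⟶ Y) : Epi (cokernelHom f).hom := inferInstanceAs (Epi (cokernel.π f.hom))

/-- `cokernelObj f` is the cokernel of `f`. -/
def isColimitCokernel (f : X ⟶ Y) :
    IsColimit (CokernelCofork.ofπ (cokernelHom f) (comp_cokernelHom f)) :=
  CokernelCofork.IsColimit.ofπ _ _
    (fun g hg => descEpi (cokernelHom f) g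
      (cokernel.desc f.hom g.hom (congrArg Hom.hom hg)) (cokernel.π_desc _ _ _))
    (fun g hg => hom_ext (cokernel.π_desc _ _ _))
    (fun g hg m hm => hom_ext (by
      rw [← cancel_epi (cokernelHom f).hom]
      exact (congrArg Hom.hom hm).trans (cokernel.π_desc _ _ _).symm))

instance : HasCokernels (FieldModule F F' C) :=
  ⟨fun f => ⟨⟨_, isColimitCokernel f⟩⟩⟩

lemma epi_hom (f : X ⟶ Y) [Epi f] : Epi f.hom := by
  refine Preadditive.epi_of_cokernel_zero ?_
  have h : cokernelHom f = 0 := by rw [← cancel_epi f, comp_cokernelHom, comp_zero]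
  exact congrArg Hom.hom h

end Cokernel

section Biproduct

variable [HasBinaryBiproducts C]

/-- The direct sum of two `F'`-modules, as a bicone. -/
@[simps]
def biprodBicone (X Y : FieldModule F F' C) : BinaryBicone X Y where
  pt := mk' (X.obj ⊞ Y.obj) (fun a => biprod.map (X.act a) (Y.act a))
    (fun a b => by ext <;> simp [act_add])
    (fun a b => by rw [mul_comm]; ext <;> simp [act_mul])
    (fun r => by rw [act_algebraMap, act_algebraMap]; ext <;> simp)
  fst := ⟨biprod.fst, fun a => biprod.map_fst _ _⟩
  snd := ⟨biprod.snd, fun a => biprod.map_snd _ _⟩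
  inl := ⟨biprod.inl, fun a => (biprod.inl_map _ _).symm⟩
  inr := ⟨biprod.inr, fun a => (biprod.inr_map _ _).symm⟩
  inl_fst := hom_ext biprod.inl_fst
  inl_snd := hom_ext biprod.inl_snd
  inr_fst := hom_ext biprod.inr_fst
  inr_snd := hom_ext biprod.inr_snd

instance : HasBinaryBiproducts (FieldModule F F' C) where
  has_binary_biproduct X Y :=
    .mk ⟨biprodBicone X Y, isBinaryBilimitOfTotal _ (hom_ext biprod.total)⟩

end Biproduct

open ZeroObject in
instance [HasZeroObject C] : HasZeroObject (FieldModule F F' C) where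
  zero := ⟨mk' (0 : C) (fun _ => 0) (by simp) (by simp) (by simp), by
    rw [IsZero.iff_id_eq_zero]
    exact hom_ext (id_zero)⟩

end FieldModule

section Abelian

variable (F : Type*) (F' : Type*) [Field F] [Field F'] [Algebra F F']
  (C : Type u) [Category.{v} C] [Abelian C] [Linear F C]

open FieldModule

instance : HasFiniteProducts (FieldModule F F' C) :=
  hasFiniteProducts_of_has_binary_and_terminal

/-- The category of `F'`-modules in an abelian category is abelian: kernels and cokernels are
those of the underlying objects. -/
instance fieldModuleAbelian : Abelian (FieldModule F F' C) where
  normalMonoOfMono f _ := ⟨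
    have := mono_hom f
    { Z := cokernelObj f
      g := cokernelHom f
      w := comp_cokernelHom f
      isLimit := KernelFork.IsLimit.ofι' _ _ fun g hg =>
        ⟨liftMono f g (Abelian.monoLift f.hom g.hom (congrArg Hom.hom hg))
          (Abelian.monoLift_comp _ _ _), hom_ext (Abelian.monoLift_comp _ _ _)⟩ }⟩
  normalEpiOfEpi f _ := ⟨
    have := epi_hom f
    { W := kernelObj f
      g := kernelHom f
      w := kernelHom_comp f
      isColimit := CokernelCofork.IsColimit.ofπ' _ _ fun g hg =>
        ⟨descEpi f g (Abelian.epiDesc f.hom g.hom (congrArg Hom.hom hg))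
          (Abelian.comp_epiDesc _ _ _), hom_ext (Abelian.comp_epiDesc _ _ _)⟩ }⟩

end Abelian


/-! ### Direct sums of copies of a simple object -/

section Semisimple

variable {A : Type u} [Category.{v} A] [Abelian A] {C : Type u₁} [Category.{v₁} C] [Abelian C]

/-- A right exact functor that maps an object of finite length to the source of a nonzero
morphism maps some simple object to the source of a nonzero morphism with the same target. -/
lemma exists_simple_hom_ne_zero (K : A ⥤ C) [K.Additive] [PreservesFiniteColimits K] {X : A}
    (hX : HasFiniteLength X) {N : C} (f : K.obj X ⟶ N) (hf : f ≠ 0) :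
    ∃ (S : A) (_ : Simple S) (g : K.obj S ⟶ N), g ≠ 0 := by
  induction hX with
  | zero X hX => exact (hf ((K.map_isZero hX).eq_of_src _ _)).elim
  | extend S hS h₁ h₃ ih =>
    by_cases h : K.map S.f ≫ f = 0
    · obtain ⟨hex, _⟩ := ((Functor.preservesFiniteColimits_tfae K).out 3 0 :).1 ‹_› S hS
      have : Epi (S.map K).g := ‹Epi (K.map S.g)›
      refine ⟨S.X₃, h₃, hex.desc f h, fun h0 => hf ?_⟩
      exact (hex.g_desc f h).symm.trans (h0 ▸ comp_zero)
    · exact ih _ h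

variable [HasCoproducts.{w} C]

/-- A functor is *compactly separating* if the objects in its image detect equality of morphisms
and every morphism from one of them to a direct sum of copies of another is a finite sum of
morphisms into the summands, each of which comes from the source category. -/
structure IsCompactlySeparating (K : A ⥤ C) : Prop where
  hom_ext : ∀ {T N : C} (f g : T ⟶ N), (∀ (X : A) (x : K.obj X ⟶ T), x ≫ f = x ≫ g) → f = g
  exists_sum : ∀ {I : Type w} (X Y : A) (g : K.obj X ⟶ ∐ fun _ : I => K.obj Y),
    ∃ c : I →₀ (X ⟶ Y), g = c.sum fun i f => K.map f ≫ Sigma.ι (fun _ : I => K.obj Y) i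

namespace IsCompactlySeparating

variable {K : A ⥤ C} [K.Additive]

/-- The components of a finite sum of morphisms into the summands of a direct sum. -/
lemma sum_π (K : A ⥤ C) [K.Additive] {I : Type w} [DecidableEq I] {X Y : A} (c : I →₀ (X ⟶ Y))
    (j : I) :
    (c.sum fun i f => K.map f ≫ Sigma.ι (fun _ : I => K.obj Y) i) ≫
      Sigma.π (fun _ : I => K.obj Y) j = K.map (c j) := by
  rw [Finsupp.sum, Preadditive.sum_comp, Finset.sum_eq_single j]
  · simp
  · intro i _ hij
    rw [Category.assoc, Sigma.ι_π_of_ne _ hij, comp_zero]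
  · intro hj
    rw [Finsupp.notMem_support_iff.1 hj]; simp

lemma exists_simple (hK : IsCompactlySeparating.{w} K) [PreservesFiniteColimits K]
    (hA : ∀ X : A, HasFiniteLength X) {T : C} (hT : ¬ IsZero T) :
    ∃ (S : A) (_ : Simple S) (g : K.obj S ⟶ T), g ≠ 0 := by
  rw [IsZero.iff_id_eq_zero] at hT
  by_contra! H
  refine hT (hK.hom_ext _ _ fun X x => ?_)
  by_cases hx : x = 0
  · simp [hx]
  · obtain ⟨S, hS, g, hg⟩ := exists_simple_hom_ne_zero K (hA X) x hx
    exact (hg (H S hS g)).elim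

/-- The `End S`-vector space of morphisms from `K S`, where `End S` acts by precomposition. -/
@[reducible]
def homModule (K : A ⥤ C) [K.Additive] (S : A) (N : C) : Module (End S)ᵐᵒᵖ (K.obj S ⟶ N) where
  smul d x := K.map d.unop ≫ x
  one_smul x := by change K.map (𝟙 S) ≫ x = x; simp
  mul_smul d e x := by
    change K.map (d.unop ≫ e.unop) ≫ x = K.map d.unop ≫ K.map e.unop ≫ x
    simp
  smul_zero d := comp_zero
  smul_add d x y := Preadditive.comp_add _ _ _ _ _ _
  add_smul d e x := by
    change K.map (d.unop + e.unop) ≫ x = K.map d.unop ≫ x + K.map e.unop ≫ x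
    rw [K.map_add, Preadditive.add_comp]
  zero_smul x := by change K.map 0 ≫ x = 0; simp

omit [HasCoproducts.{w} C] in
lemma homModule_smul (S : A) (N : C) (d : (End S)ᵐᵒᵖ) (x : K.obj S ⟶ N) :
    letI := homModule K S N
    d • x = K.map d.unop ≫ x := rfl

/-- Linearly independent morphisms from the image of a simple object are the components of a
monomorphism from a direct sum. -/
lemma mono_desc_of_linearIndependent (hK : IsCompactlySeparating.{w} K)
    [PreservesFiniteColimits K] (hA : ∀ X : A, HasFiniteLength X) {S : A} [Simple S] {N : C}
    {I : Type w} (q : I → (K.obj S ⟶ N))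
    (hq : letI := homModule K S N; LinearIndependent (End S)ᵐᵒᵖ q) :
    Mono (Sigma.desc q) := by
  classical
  let := homModule K S N
  refine Preadditive.mono_of_kernel_zero ?_
  by_contra hne
  have hz : ¬ IsZero (kernel (Sigma.desc q)) := fun h => hne (h.eq_of_src _ _)
  obtain ⟨S', _, g, hg⟩ := hK.exists_simple hA hz
  have hg' : g ≫ kernel.ι (Sigma.desc q) ≠ 0 := fun h => hg (by
    rw [← cancel_mono (kernel.ι (Sigma.desc q)), h, zero_comp])
  obtain ⟨c, hc⟩ := hK.exists_sum S' S (g ≫ kernel.ι (Sigma.desc q))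
  have hc0 : c.sum (fun i f => K.map f ≫ q i) = 0 := by
    have h := hc =≫ Sigma.desc q
    rw [Category.assoc, kernel.condition, comp_zero, Finsupp.sum, Preadditive.sum_comp] at h
    simpa [Finsupp.sum] using h.symm
  -- some component of `g` is an isomorphism, which turns `g` into a linear relation
  obtain ⟨j, hj⟩ : ∃ j, c j ≠ 0 := by
    by_contra! h
    obtain rfl : c = 0 := Finsupp.ext h
    exact hg' (by simpa using hc)
  have := isIso_of_hom_simple hj
  let e : S ⟶ S' := inv (c j)
  let l : I →₀ (End S)ᵐᵒᵖ := c.mapRange (fun f => MulOpposite.op (e ≫ f : S ⟶ S)) (by simp)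
  have hl : Finsupp.linearCombination (End S)ᵐᵒᵖ q l = 0 := by
    rw [Finsupp.linearCombination_apply, Finsupp.sum_mapRange_index (by simp)]
    have h : K.map e ≫ c.sum (fun i f => K.map f ≫ q i) = 0 := by rw [hc0, comp_zero]
    rw [Finsupp.sum, Preadditive.comp_sum] at h
    rw [Finsupp.sum, ← h]
    refine Finset.sum_congr rfl fun i _ => ?_
    rw [homModule_smul]
    simp
  have h0 := DFunLike.congr_fun (linearIndependent_iff.1 hq l hl) j
  have h1 : (e ≫ c j : S ⟶ S) = 0 := congrArg MulOpposite.unop h0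
  rw [IsIso.inv_hom_id] at h1
  exact id_nonzero S h1

/-- A family of morphisms from the image of a simple object contains a subfamily whose span is the
same, so that the direct sum over the subfamily maps isomorphically to any quotient of the whole
direct sum. Hence every quotient of a direct sum of copies splits. -/
lemma exists_section (hK : IsCompactlySeparating.{w} K) [PreservesFiniteColimits K]
    (hA : ∀ X : A, HasFiniteLength X) {S : A} [Simple S] {I : Type w} {N : C}
    (p : (∐ fun _ : I => K.obj S) ⟶ N) [Epi p] : ∃ s, s ≫ p = 𝟙 N := by
  let := homModule K S N
  let q : I → (K.obj S ⟶ N) := fun i => Sigma.ι (fun _ : I => K.obj S) i ≫ p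
  obtain ⟨J, a, -, hspan, hind⟩ := exists_linearIndependent' (End S)ᵐᵒᵖ q
  have hm : Mono (Sigma.desc (q ∘ a)) := hK.mono_desc_of_linearIndependent hA _ hind
  have he : Epi (Sigma.desc (q ∘ a)) := by
    refine Preadditive.epi_of_cancel_zero _ fun {R} u hu => ?_
    let W : Submodule (End S)ᵐᵒᵖ (K.obj S ⟶ N) :=
      { carrier := {x | x ≫ u = 0}
        add_mem' := fun {x y} hx hy => by
          simp only [Set.mem_ofPred_eq] at hx hy ⊢
          rw [Preadditive.add_comp, hx, hy, add_zero]
        zero_mem' := zero_comp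
        smul_mem' := fun d x hx => by
          simp only [Set.mem_ofPred_eq] at hx ⊢
          rw [homModule_smul, Category.assoc, hx, comp_zero] }
    have hW : Submodule.span (End S)ᵐᵒᵖ (Set.range q) ≤ W := by
      rw [← hspan, Submodule.span_le]
      rintro _ ⟨j, rfl⟩
      have := Sigma.ι (fun _ : J => K.obj S) j ≫= hu
      rw [← Category.assoc, Sigma.ι_desc, comp_zero] at this
      exact this
    rw [← cancel_epi p, comp_zero]
    refine Sigma.hom_ext _ _ fun i => ?_
    have hi : q i ≫ u = 0 := hW (Submodule.subset_span ⟨i, rfl⟩)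
    rw [← Category.assoc, hi, comp_zero]
  have := isIso_of_mono_of_epi (Sigma.desc (q ∘ a))
  refine ⟨inv (Sigma.desc (q ∘ a)) ≫ Sigma.desc fun j => Sigma.ι (fun _ : I => K.obj S) (a j), ?_⟩
  rw [Category.assoc, IsIso.inv_comp_eq, Category.comp_id]
  refine Sigma.hom_ext _ _ fun j => ?_
  simp [q]

/-- Every subobject of a direct sum of copies of the image of a simple object is a direct
summand. -/
lemma exists_retraction (hK : IsCompactlySeparating.{w} K) [PreservesFiniteColimits K]
    (hA : ∀ X : A, HasFiniteLength X) {S : A} [Simple S] {I : Type w} {N : C}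
    (i : N ⟶ (∐ fun _ : I => K.obj S)) [Mono i] : ∃ r, i ≫ r = 𝟙 N := by
  obtain ⟨s, hs⟩ := hK.exists_section hA (cokernel.π i)
  have h : (𝟙 _ - cokernel.π i ≫ s) ≫ cokernel.π i = 0 := by
    rw [Preadditive.sub_comp, Category.assoc, hs]; simp
  refine ⟨Abelian.monoLift i _ h, ?_⟩
  rw [← cancel_mono i, Category.assoc, Abelian.monoLift_comp, Preadditive.comp_sub,
    cokernel.condition_assoc]
  simp

end IsCompactlySeparating

end Semisimple

/-! ### Ind-objects: the image of `A` is compactly separating -/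

section Compact

variable {B : Type u} [SmallCategory B]

open Opposite in
/-- Objects of `B` are finitely presented in `Ind B`: a morphism to a filtered colimit factors
through a stage. -/
lemma ind_exists_factor {J : Type w} [SmallCategory J]
    [PreservesColimitsOfShape J (Ind.inclusion B)]
    (X : B) {G : J ⥤ Ind B} {c : Cocone G} (hc : IsColimit c) (g : Ind.yoneda.obj X ⟶ c.pt) :
    ∃ (j : J) (h : Ind.yoneda.obj X ⟶ G.obj j), h ≫ c.ι.app j = g := by
  let Φ := Ind.inclusion B ⋙ (evaluation _ _).obj (op X)
  let η := Ind.yonedaCompInclusion.app X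
  obtain ⟨j, y, hy⟩ := Types.jointly_surjective _ (isColimitOfPreserves Φ hc)
    (yonedaEquiv (η.inv ≫ (Ind.inclusion B).map g))
  refine ⟨j, (Ind.inclusion B).preimage (η.hom ≫ yonedaEquiv.symm y), ?_⟩
  apply (Ind.inclusion B).map_injective
  rw [Functor.map_comp, Functor.map_preimage, Category.assoc, ← Iso.eq_inv_comp]
  apply yonedaEquiv.injective
  rw [← hy, yonedaEquiv_comp, Equiv.apply_symm_apply]
  rfl

lemma preservesColimitsOfShape_inclusion {J : Type w} [SmallCategory J] [IsFiltered J]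
    (B : Type (max u w)) [SmallCategory B] :
    PreservesColimitsOfShape J (Ind.inclusion B) :=
  have : IsFiltered (AsSmall.{max u w} J) := inferInstance
  have : PreservesColimitsOfShape (AsSmall.{max u w} J) (Ind.inclusion B) := inferInstance
  preservesColimitsOfShape_of_equiv AsSmall.equiv.symm _

end Compact

section Compact

variable (A : Type u) [Category.{v} A] [Abelian A]

instance : (toIndCat.{w} A).Full := inferInstanceAs (AsSmall.equiv.functor ⋙ Ind.yoneda).Full
instance : (toIndCat.{w} A).Faithful :=
  inferInstanceAs (AsSmall.equiv.functor ⋙ Ind.yoneda).Faithful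
instance : PreservesFiniteColimits (toIndCat.{w} A) :=
  have : PreservesFiniteColimits (AsSmall.up : A ⥤ AsSmall.{w} A) :=
    inferInstanceAs (PreservesFiniteColimits AsSmall.equiv.functor)
  comp_preservesFiniteColimits _ _

open CoproductsFromFiniteFiltered in
/-- Morphisms from objects of `A` separate morphisms in `Ind A`, and since objects of `A` are
finitely presented and a direct sum is the filtered colimit of its finite subsums, they factor
through finite subsums. -/
lemma isCompactlySeparating_toIndCat : IsCompactlySeparating.{w} (toIndCat.{w} A) where
  hom_ext f g h := ind_hom_ext fun U x => h (AsSmall.down.obj U) x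
  exists_sum {I} X Y g := by
    classical
    let K := toIndCat.{w} A
    have : HasColimitsOfShape (Finset (Discrete I)) (IndCat.{w} A) :=
      hasColimitsOfShape_of_equivalence (AsSmall.equiv (C := Finset (Discrete I))).symm
    have : PreservesColimitsOfShape (Finset (Discrete I)) (Ind.inclusion (AsSmall.{w} A)) :=
      preservesColimitsOfShape_inclusion _
    obtain ⟨T, h, hh⟩ := ind_exists_factor (AsSmall.up.obj X)
      (isColimitFiniteSubproductsCocone fun _ : I => K.obj Y) g
    let h' : K.obj X ⟶ ∐ fun _ : T => K.obj Y := h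
    have hg : g = ∑ a ∈ T.attach, h' ≫ Sigma.π (fun _ : T => K.obj Y) a ≫
        Sigma.ι (fun _ : I => K.obj Y) a.1.as :=
      hh.symm.trans ((congrArg (h ≫ ·) (finiteSubcoproductsCocone_ι_app_eq_sum _ T)).trans
        (Preadditive.comp_sum _ h' _))
    let Φ : (I →₀ (X ⟶ Y)) →+ (K.obj X ⟶ ∐ fun _ : I => K.obj Y) :=
      Finsupp.liftAddHom fun i => (Preadditive.rightComp (K.obj X)
        (Sigma.ι (fun _ : I => K.obj Y) i)).comp K.mapAddHom
    refine ⟨∑ a ∈ T.attach, Finsupp.single a.1.as (K.preimage (h' ≫ Sigma.π _ a)), ?_⟩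
    change g = Φ _
    rw [map_sum, hg]
    refine Finset.sum_congr rfl fun a _ => ?_
    rw [Finsupp.liftAddHom_apply_single]
    change _ = K.map (K.preimage _) ≫ _
    rw [Functor.map_preimage, Category.assoc]

end Compact


/-! ### Free modules -/

section Free

variable {F : Type*} [Field F] {C : Type u} [Category.{v} C] [Preadditive C] [Linear F C]

namespace ExternalTensor

variable {F' : Type*} [Field F'] [Algebra F F'] {X Y : C} (T : ExternalTensor F F' X)
  {M : FieldModule F F' C}

/-- The morphism underlying a homomorphism from the free module. -/
def toHom (f : T.toFieldModule ⟶ M) : T.obj ⟶ M.obj := f.hom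

lemma lmap_toHom (f : T.toFieldModule ⟶ M) (a : F') :
    T.lmap (LinearMap.mulLeft F a) ≫ T.toHom f = T.toHom f ≫ M.act a := f.comm a

lemma toFieldModule_hom_ext {f g : T.toFieldModule ⟶ M}
    (h : ∀ m, T.ι m ≫ T.toHom f = T.ι m ≫ T.toHom g) : f = g :=
  FieldModule.hom_ext (T.hom_ext h)

lemma ι_toHom (f : T.toFieldModule ⟶ M) (m : F') :
    T.ι m ≫ T.toHom f = (T.ι 1 ≫ T.toHom f) ≫ M.act m := by
  rw [Category.assoc, ← lmap_toHom, ι_lmap_assoc]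
  simp

/-- A morphism from `X` to the underlying object of a module extends to the free module on `X`. -/
def ofHom (g : X ⟶ M.obj) : T.toFieldModule ⟶ M where
  hom := T.desc
    { toFun := fun a => g ≫ M.act a
      map_add' := fun a b => by rw [M.act_add, Preadditive.comp_add]
      map_smul' := fun r a => by
        rw [Algebra.smul_def, M.act_mul, M.act_algebraMap]
        simp }
  comm a := T.hom_ext fun m => by
    change T.ι m ≫ T.lmap (LinearMap.mulLeft F a) ≫ T.desc _ = T.ι m ≫ T.desc _ ≫ M.act a
    simp [M.act_mul, mul_comm a m]

lemma ι_toHom_ofHom (g : X ⟶ M.obj) (m : F') : T.ι m ≫ T.toHom (T.ofHom g) = g ≫ M.act m :=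
  T.fac _ m

/-- The universal property of the free module: a homomorphism is determined by its restriction
along `1 ∈ F'`, which is arbitrary. -/
def homEquiv (M : FieldModule F F' C) : (T.toFieldModule ⟶ M) ≃+ (X ⟶ M.obj) where
  toFun f := T.ι 1 ≫ T.toHom f
  invFun g := T.ofHom g
  left_inv f := T.toFieldModule_hom_ext fun m => by rw [ι_toHom_ofHom, ← ι_toHom]
  right_inv g := by simp [ι_toHom_ofHom]
  map_add' f g := Preadditive.comp_add _ _ _ _ _ _

lemma homEquiv_comp {N : FieldModule F F' C} (f : T.toFieldModule ⟶ M) (g : M ⟶ N) :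
    T.homEquiv N (f ≫ g) = T.homEquiv M f ≫ g.hom :=
  (Category.assoc _ _ _).symm

/-- Functoriality of the free module. -/
def freeMap (T' : ExternalTensor F F' Y) (f : X ⟶ Y) : T.toFieldModule ⟶ T'.toFieldModule where
  hom := T.rmap T' f
  comm a := T.lmap_rmap T' f (LinearMap.mulLeft F a)

lemma homEquiv_freeMap_comp (T' : ExternalTensor F F' Y) (f : X ⟶ Y) (g : T'.toFieldModule ⟶ M) :
    T.homEquiv M (T.freeMap T' f ≫ g) = f ≫ T'.homEquiv M g := by
  change T.ι 1 ≫ T.rmap T' f ≫ T'.toHom g = f ≫ T'.ι 1 ≫ T'.toHom g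
  simp

lemma homEquiv_smul_freeMap (T' : ExternalTensor F F' Y) (f : X ⟶ Y) (a : F') :
    T.homEquiv _ (a • T.freeMap T' f) = f ≫ T'.ι a := by
  change T.ι 1 ≫ T.lmap _ ≫ T.rmap T' f = f ≫ T'.ι a
  simp

lemma freeMap_add (T' : ExternalTensor F F' Y) (f g : X ⟶ Y) :
    T.freeMap T' (f + g) = T.freeMap T' f + T.freeMap T' g :=
  FieldModule.hom_ext (T.hom_ext fun m => by
    change T.ι m ≫ T.rmap T' (f + g) = T.ι m ≫ (T.rmap T' f + T.rmap T' g)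
    simp)

lemma freeMap_smul (T' : ExternalTensor F F' Y) (r : F) (f : X ⟶ Y) :
    T.freeMap T' (r • f) = r • T.freeMap T' f :=
  FieldModule.hom_ext (T.hom_ext fun m => by
    change T.ι m ≫ T.rmap T' (r • f) = T.ι m ≫ (r • T.rmap T' f)
    simp)

end ExternalTensor

variable {F' : Type w} [Field F'] [Algebra F F'] [HasCoproducts.{w} C]

/-- Homomorphisms from the free module on `X` are morphisms from `X`. -/
def freeHomEquiv (X : C) (M : FieldModule F F' C) :
    ((freeModule F F').obj X ⟶ M) ≃+ (X ⟶ M.obj) :=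
  (externalTensor F F' X).homEquiv M

lemma freeHomEquiv_comp {X : C} {M N : FieldModule F F' C} (f : (freeModule F F').obj X ⟶ M)
    (g : M ⟶ N) : freeHomEquiv X N (f ≫ g) = freeHomEquiv X M f ≫ g.hom :=
  (externalTensor F F' X).homEquiv_comp f g

lemma freeHomEquiv_map_comp {X Y : C} {M : FieldModule F F' C} (f : X ⟶ Y)
    (g : (freeModule F F').obj Y ⟶ M) :
    freeHomEquiv X M ((freeModule F F').map f ≫ g) = f ≫ freeHomEquiv Y M g :=
  (externalTensor F F' X).homEquiv_freeMap_comp (externalTensor F F' Y) f g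

variable (F C F') in
/-- The free module functor is left adjoint to the forgetful functor. -/
def freeAdjunction : freeModule F F' ⊣ FieldModule.forget F F' C :=
  Adjunction.mkOfHomEquiv
    { homEquiv := fun X M => (freeHomEquiv X M).toEquiv
      homEquiv_naturality_left_symm := fun {X' X M} f g => by
        apply (freeHomEquiv X' M).injective
        refine Eq.trans ?_ (freeHomEquiv_map_comp f ((freeHomEquiv X M).symm g)).symm
        exact ((freeHomEquiv X' M).apply_symm_apply _).trans
          (congrArg (f ≫ ·) ((freeHomEquiv X M).apply_symm_apply g).symm)
      homEquiv_naturality_right := fun f g => freeHomEquiv_comp f g }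

instance : (freeModule F F' : C ⥤ FieldModule F F' C).Additive where
  map_add {_ _ f g} := ExternalTensor.freeMap_add _ _ f g

instance : (freeModule F F' : C ⥤ FieldModule F F' C).Linear F where
  map_smul f r := ExternalTensor.freeMap_smul _ _ r f

instance : PreservesFiniteColimits (freeModule F F' : C ⥤ FieldModule F F' C) :=
  have : PreservesColimitsOfSize.{0, 0} (freeModule F F' : C ⥤ FieldModule F F' C) :=
    (freeAdjunction F C F').leftAdjoint_preservesColimits
  PreservesColimitsOfSize.preservesFiniteColimits _

/-- Under the adjunction, `a • t h` corresponds to `h` followed by the inclusion labelled `a`. -/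
lemma freeHomEquiv_smul_map {X Y : C} (a : F') (h : X ⟶ Y) :
    freeHomEquiv X _ (a • (freeModule F F').map h) = h ≫ (externalTensor F F' Y).ι a :=
  (externalTensor F F' X).homEquiv_smul_freeMap (externalTensor F F' Y) h a

lemma externalTensor_ι_basis (Y : C) (i : Module.Basis.ofVectorSpaceIndex F F') :
    (externalTensor F F' Y).ι (Module.Basis.ofVectorSpace F F' i) =
      Sigma.ι (fun _ : Module.Basis.ofVectorSpaceIndex F F' => Y) i :=
  (Module.Basis.ofVectorSpace F F').constr_basis F
    (fun i => Sigma.ι (fun _ : Module.Basis.ofVectorSpaceIndex F F' => Y) i) i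

end Free

/-! ### Extension of scalars along a compactly separating embedding -/

section Extension

variable {F : Type*} [Field F] {F' : Type w} [Field F'] [Algebra F F']
  {A : Type u} [Category.{v} A] [Abelian A]
  {C : Type u₁} [Category.{v₁} C] [Abelian C] [Linear F C] [HasCoproducts.{w} C]
  {K : A ⥤ C} [K.Additive]

open IsCompactlySeparating

/-- The comparison map in coordinates with respect to a basis of `F'`: a family of morphisms
corresponds to the sum of its members, followed by the inclusions of the summands. -/
lemma freeHomEquiv_relativeMap [Linear F A] [K.Linear F]
    [DecidableEq (Module.Basis.ofVectorSpaceIndex F F')] (X Y : A)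
    (c : Module.Basis.ofVectorSpaceIndex F F' →₀ (X ⟶ Y)) :
    freeHomEquiv (K.obj X) _ (relativeMap F F' (K ⋙ freeModule F F') X Y
      ((TensorProduct.equivFinsuppOfBasisLeft (Module.Basis.ofVectorSpace F F')).symm c)) =
    c.sum fun i f => K.map f ≫
      Sigma.ι (fun _ : Module.Basis.ofVectorSpaceIndex F F' => K.obj Y) i := by
  rw [TensorProduct.equivFinsuppOfBasisLeft_symm_apply, Finsupp.sum, map_sum, map_sum]
  refine Finset.sum_congr rfl fun i _ => ?_
  rw [relativeMap_tmul]
  refine (freeHomEquiv_smul_map _ _).trans ?_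
  rw [externalTensor_ι_basis]
  rfl

/-- The comparison maps of `t` are bijective, since morphisms to a direct sum of copies are exactly
the finitely supported families. -/
lemma isRelativelyFullyFaithful_free [Linear F A] [K.Linear F] [K.Faithful]
    (hK : IsCompactlySeparating.{w} K) :
    IsRelativelyFullyFaithful F F' (K ⋙ freeModule F F') := by
  classical
  intro X Y
  let e := TensorProduct.equivFinsuppOfBasisLeft (N := X ⟶ Y) (Module.Basis.ofVectorSpace F F')
  rw [← Function.Bijective.of_comp_iff _ e.symm.bijective,
    ← Function.Bijective.of_comp_iff' (freeHomEquiv (K.obj X) _).bijective]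
  constructor
  · intro c d h
    simp only [Function.comp_apply, e, freeHomEquiv_relativeMap] at h
    ext i
    apply K.map_injective
    rw [← sum_π K c, ← sum_π K d, h]
  · intro g
    obtain ⟨c, hc⟩ := hK.exists_sum X Y g
    exact ⟨c, (freeHomEquiv_relativeMap X Y c).trans hc.symm⟩

omit [Linear F C] in
/-- A direct sum of copies of a monomorphism from `A` is a monomorphism: this can be tested on
finite sums of morphisms into the summands, where it holds componentwise. -/
lemma IsCompactlySeparating.mono_of_components [K.Faithful] (hK : IsCompactlySeparating.{w} K)
    {I : Type w} {X Y : A} (f : X ⟶ Y) [Mono f]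
    (φ : (∐ fun _ : I => K.obj X) ⟶ ∐ fun _ : I => K.obj Y)
    (hφ : ∀ i, Sigma.ι (fun _ : I => K.obj X) i ≫ φ =
      K.map f ≫ Sigma.ι (fun _ : I => K.obj Y) i) : Mono φ := by
  classical
  refine Preadditive.mono_of_cancel_zero _ fun {R} g hg => hK.hom_ext _ _ fun Z x => ?_
  obtain ⟨c, hc⟩ := hK.exists_sum Z X (x ≫ g)
  have h0 : (c.mapRange (· ≫ f) zero_comp).sum (fun i h => K.map h ≫
      Sigma.ι (fun _ : I => K.obj Y) i) = 0 := by
    have h1 : (x ≫ g) ≫ φ = 0 := by rw [Category.assoc, hg, comp_zero]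
    rw [hc, Finsupp.sum, Preadditive.sum_comp] at h1
    rw [Finsupp.sum_mapRange_index (by simp), Finsupp.sum, ← h1]
    exact Finset.sum_congr rfl fun i _ => by simp [hφ]
  have hc0 : c = 0 := by
    ext i
    have h := sum_π K (c.mapRange (· ≫ f) zero_comp) i
    rw [h0, zero_comp, Finsupp.mapRange_apply] at h
    rw [← cancel_mono f]
    exact K.map_injective (h.symm.trans (by simp))
  rw [hc, hc0]
  simp

/-- The functor `t` preserves monomorphisms. -/
lemma mono_free_map [K.Faithful] (hK : IsCompactlySeparating.{w} K) {X Y : A} (f : X ⟶ Y)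
    [Mono f] : Mono ((K ⋙ freeModule F F').map f) := by
  let T := externalTensor F F' (K.obj X)
  let T' := externalTensor F F' (K.obj Y)
  have hm : Mono (T.rmap T' (K.map f)) := by
    refine hK.mono_of_components f (T.rmap T' (K.map f)) fun i => ?_
    have h := T.ι_rmap T' (K.map f) (Module.Basis.ofVectorSpace F F' i)
    rwa [externalTensor_ι_basis, externalTensor_ι_basis] at h
  exact ⟨fun g h e => FieldModule.hom_ext
    (hm.right_cancellation _ _ (congrArg FieldModule.Hom.hom e))⟩

lemma preservesFiniteLimits_free [K.Faithful] (hK : IsCompactlySeparating.{w} K)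
    [PreservesFiniteColimits K] : PreservesFiniteLimits (K ⋙ freeModule F F') := by
  have hp : PreservesFiniteColimits (K ⋙ freeModule F F') := comp_preservesFiniteColimits _ _
  refine ((Functor.preservesFiniteLimits_tfae (K ⋙ freeModule F F')).out 0 3 :).1 fun S hS => ?_
  have := hS.mono_f
  exact ⟨(((Functor.preservesFiniteColimits_tfae (K ⋙ freeModule F F')).out 3 0 :).1 hp S hS).1,
    mono_free_map hK S.f⟩

end Extension


/-! ### Finiteness of scalar extensions -/

section Finiteness

variable {F : Type*} [Field F] {F' : Type w} [Field F'] [Algebra F F']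
  {A : Type u} [Category.{v} A] [Abelian A]
  {C : Type u₁} [Category.{v₁} C] [Abelian C] [Linear F C] [HasCoproducts.{w} C]
  {K : A ⥤ C} [K.Additive]

lemma IsFFinite.finite_hom [Linear F A] (hA : IsFFinite F A) (X Y : A) :
    Module.Finite F (X ⟶ Y) := by
  have : Module.Finite F ((X ⊞ Y) ⟶ (X ⊞ Y)) := hA.finite_end (X ⊞ Y)
  refine .of_injective (Linear.leftComp F (X ⊞ Y) (biprod.fst : X ⊞ Y ⟶ X) ∘ₗ
    Linear.rightComp F X (biprod.inr : Y ⟶ X ⊞ Y)) fun f g h => ?_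
  have h' : (biprod.fst : X ⊞ Y ⟶ X) ≫ f ≫ (biprod.inr : Y ⟶ X ⊞ Y) =
      biprod.fst ≫ g ≫ biprod.inr := h
  exact (cancel_mono _).1 ((cancel_epi _).1 h')

lemma finite_hom_free_free [Linear F A] [K.Linear F] [K.Faithful]
    (hK : IsCompactlySeparating.{w} K) (hA : IsFFinite F A) (X Y : A) :
    Module.Finite F' ((freeModule F F').obj (K.obj X) ⟶ (freeModule F F').obj (K.obj Y)) :=
  have := hA.finite_hom X Y
  .of_surjective (relativeMap F F' (K ⋙ freeModule F F') X Y)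
    (isRelativelyFullyFaithful_free hK X Y).2

/-- Homomorphisms from free modules lift along quotients of the free module on a simple object,
since the latter split as morphisms of underlying objects. -/
lemma exists_lift_free (hK : IsCompactlySeparating.{w} K) [PreservesFiniteColimits K]
    (hA : ∀ X : A, HasFiniteLength X) {S : A} [Simple S] {N : FieldModule F F' C}
    (p : (freeModule F F').obj (K.obj S) ⟶ N) [Epi p] {X : C}
    (g : (freeModule F F').obj X ⟶ N) : ∃ g', g' ≫ p = g := by
  let p' : (∐ fun _ : Module.Basis.ofVectorSpaceIndex F F' => K.obj S) ⟶ N.obj := p.hom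
  have : Epi p' := FieldModule.epi_hom p
  obtain ⟨s, hs⟩ := hK.exists_section hA p'
  refine ⟨(freeHomEquiv X _).symm (freeHomEquiv X N g ≫ s), (freeHomEquiv X N).injective ?_⟩
  rw [freeHomEquiv_comp, AddEquiv.apply_symm_apply]
  exact (Category.assoc _ s p').trans
    ((congrArg (freeHomEquiv X N g ≫ ·) hs).trans (Category.comp_id _))

/-- A submodule of the free module on a simple object is generated by the homomorphisms from that
free module. -/
lemma isIso_of_surjective_hom_free (hK : IsCompactlySeparating.{w} K) [PreservesFiniteColimits K]
    (hA : ∀ X : A, HasFiniteLength X) {S : A} [Simple S] {Y Z : FieldModule F F' C} (j : Y ⟶ Z)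
    (i : Z ⟶ (freeModule F F').obj (K.obj S)) [Mono j] [Mono i]
    (h : ∀ g : (freeModule F F').obj (K.obj S) ⟶ Z, ∃ g', g' ≫ j = g) : IsIso j := by
  let i' : Z.obj ⟶ (∐ fun _ : Module.Basis.ofVectorSpaceIndex F F' => K.obj S) := i.hom
  have : Mono i' := FieldModule.mono_hom i
  obtain ⟨r, hr⟩ := hK.exists_retraction hA i'
  have hl (b : Module.Basis.ofVectorSpaceIndex F F') :
      ∃ l : K.obj S ⟶ Y.obj, l ≫ j.hom = Sigma.ι (fun _ => K.obj S) b ≫ r := by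
    obtain ⟨g', hg'⟩ := h ((freeHomEquiv _ Z).symm (Sigma.ι (fun _ => K.obj S) b ≫ r))
    refine ⟨freeHomEquiv _ Y g', ?_⟩
    rw [← freeHomEquiv_comp, hg', AddEquiv.apply_symm_apply]
  choose l hl using hl
  have hlr : Sigma.desc l ≫ j.hom = r := Sigma.hom_ext _ _ fun b => by simp [hl]
  have : Epi (i' ≫ r) := by rw [hr]; infer_instance
  have : Epi r := epi_of_epi i' r
  have : Epi (Sigma.desc l ≫ j.hom) := by rw [hlr]; infer_instance
  have : Epi j.hom := epi_of_epi (Sigma.desc l) j.hom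
  have : Mono j.hom := FieldModule.mono_hom j
  have : IsIso j.hom := isIso_of_mono_of_epi j.hom
  exact FieldModule.isIso_of_isIso_hom j

/-- The free module on a simple object has finite length: its submodules are distinguished by the
`F'`-dimension of the space of homomorphisms from the free module itself. -/
lemma hasFiniteLength_free_of_simple [Linear F A] [K.Linear F] [K.Faithful]
    (hK : IsCompactlySeparating.{w} K) [PreservesFiniteColimits K] (hA : IsFFinite F A)
    (S : A) [Simple S] : HasFiniteLength ((freeModule F F').obj (K.obj S)) := by
  let T : FieldModule F F' C := (freeModule F F').obj (K.obj S)
  refine .of_strictMono (fun Y => Module.finrank F' (T ⟶ Y)) T fun {Y Z} j i _ _ hj => ?_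
  have hT : Module.Finite F' (T ⟶ T) := finite_hom_free_free hK hA S S
  have hZ : Module.Finite F' (T ⟶ Z) := .of_injective (Linear.rightComp F' T i)
    fun _ _ h => (cancel_mono i).1 h
  have hinj : Function.Injective (Linear.rightComp F' T j) := fun _ _ h => (cancel_mono j).1 h
  have hY : Module.Finite F' (T ⟶ Y) := .of_injective _ hinj
  refine lt_of_le_of_ne (LinearMap.finrank_le_finrank_of_injective hinj) fun heq => hj ?_
  exact isIso_of_surjective_hom_free hK hA.hasFiniteLength j i
    ((LinearMap.injective_iff_surjective_of_finrank_eq_finrank heq).1 hinj)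

lemma hasFiniteLength_free [Linear F A] [K.Linear F] [K.Faithful]
    (hK : IsCompactlySeparating.{w} K) [PreservesFiniteColimits K] (hA : IsFFinite F A) (X : A) :
    HasFiniteLength ((K ⋙ freeModule F F').obj X) := by
  have := preservesFiniteLimits_free (F := F) (F' := F') hK
  induction hA.hasFiniteLength X with
  | zero X hX => exact .zero _ (Functor.map_isZero _ hX)
  | extend S hS h₁ h₃ ih =>
    have := hS.mono_f
    have := hS.epi_g
    exact .of_shortExact (hS.map_of_exact (K ⋙ freeModule F F')) ih
      (hasFiniteLength_free_of_simple hK hA S.X₃)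

/-- Every simple module is a quotient of the free module on a simple object. -/
lemma exists_epi_free (hK : IsCompactlySeparating.{w} K) [PreservesFiniteColimits K]
    (hA : ∀ X : A, HasFiniteLength X) (N : FieldModule F F' C) [Simple N] :
    ∃ (S : A) (_ : Simple S) (p : (freeModule F F').obj (K.obj S) ⟶ N), Epi p := by
  have hN : ¬ IsZero N.obj := fun h => Simple.not_isZero N (by
    rw [IsZero.iff_id_eq_zero] at h ⊢
    exact FieldModule.hom_ext h)
  obtain ⟨S, hS, g, hg⟩ := hK.exists_simple hA hN
  refine ⟨S, hS, (freeHomEquiv _ N).symm g, epi_of_nonzero_to_simple fun h => hg ?_⟩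
  rwa [AddEquiv.symm_apply_eq, map_zero] at h

/-- Homomorphisms from a free module to a module of finite length form a finite-dimensional space:
for a simple target they lift to a free module of which the target is a quotient. -/
lemma finite_hom_free_of_hasFiniteLength [Linear F A] [K.Linear F] [K.Faithful]
    (hK : IsCompactlySeparating.{w} K) [PreservesFiniteColimits K] (hA : IsFFinite F A)
    {N : FieldModule F F' C} (hN : HasFiniteLength N) (X : A) :
    Module.Finite F' ((freeModule F F').obj (K.obj X) ⟶ N) := by
  induction hN with
  | zero N hN =>
    have : Subsingleton ((freeModule F F').obj (K.obj X) ⟶ N) := ⟨hN.eq_of_tgt⟩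
    infer_instance
  | extend S hS h₁ h₃ ih =>
    refine finite_hom_of_shortExact_right F' _ hS ih ?_
    obtain ⟨T, _, p, _⟩ := exists_epi_free hK hA.hasFiniteLength S.X₃
    have := finite_hom_free_free (F := F) (F' := F') hK hA X T
    exact .of_surjective (Linear.rightComp F' _ p) fun g =>
      exists_lift_free hK hA.hasFiniteLength p g

/-- Spaces of homomorphisms between modules of finite length are finite-dimensional. -/
lemma finite_hom_of_hasFiniteLength [Linear F A] [K.Linear F] [K.Faithful]
    (hK : IsCompactlySeparating.{w} K) [PreservesFiniteColimits K] (hA : IsFFinite F A)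
    {M N : FieldModule F F' C} (hM : HasFiniteLength M) (hN : HasFiniteLength N) :
    Module.Finite F' (M ⟶ N) := by
  induction hM with
  | zero M hM =>
    have : Subsingleton (M ⟶ N) := ⟨hM.eq_of_src⟩
    infer_instance
  | extend S hS h₁ h₃ ih =>
    refine finite_hom_of_shortExact_left F' _ hS ih ?_
    obtain ⟨T, _, p, _⟩ := exists_epi_free hK hA.hasFiniteLength S.X₃
    have := finite_hom_free_of_hasFiniteLength hK hA hN T
    exact finite_hom_of_epi F' p N

end Finiteness


/-! ### The full subcategory of modules of finite length -/

section Lift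

variable {F : Type*} {F' : Type*} [Field F] [Field F'] [Algebra F F']
  {C : Type u} [Category.{v} C] [Preadditive C] [Linear F C]
  {D : Type u₁} [Category.{v₁} D] [Preadditive D]
  (P : ObjectProperty D) (G : C ⥤ D) (hG : ∀ X, P (G.obj X))

omit [Linear F C] in
lemma additive_lift [G.Additive] : (P.lift G hG).Additive where
  map_add := P.hom_ext G.map_add

lemma linear_lift [Linear F D] [G.Linear F] : (P.lift G hG).Linear F where
  map_smul f r := P.hom_ext (Functor.Linear.map_smul f r)

/-- Relative full faithfulness only concerns the morphisms of the target category, so that it is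
inherited by a functor with values in a full subcategory. -/
lemma IsRelativelyFullyFaithful.lift [Linear F D] [Linear F' D]
    [∀ X Y : D, IsScalarTower F F' (X ⟶ Y)] [G.Additive] [G.Linear F]
    [(P.lift G hG).Additive] [(P.lift G hG).Linear F]
    [∀ X Y : P.FullSubcategory, IsScalarTower F F' (X ⟶ Y)]
    (h : IsRelativelyFullyFaithful F F' G) :
    IsRelativelyFullyFaithful F F' (P.lift G hG) := by
  intro X Y
  have hc : P.ι.map ∘ relativeMap F F' (P.lift G hG) X Y = relativeMap F F' G X Y := by
    ext x
    induction x with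
    | zero => simp
    | tmul a f => rfl
    | add x y hx hy =>
      rw [Function.comp_apply] at hx hy ⊢
      rw [map_add, map_add, Functor.map_add, hx, hy]
  refine (Function.Bijective.of_comp_iff' (P.fullyFaithfulι.homEquiv).bijective _).1 ?_
  exact hc ▸ h X Y

end Lift

section FullSubcategory

variable (F : Type*) [Field F] (F' : Type w) [Field F'] [Algebra F F']
  (A : Type u) [Category.{v} A] [Abelian A] [Linear F A]

instance : (finiteLength F F' A).IsSerreClass :=
  isSerreClass_hasFiniteLength (C := IndModule F F' A)

instance : (finiteLength F F' A).IsClosedUnderFiniteProducts :=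
  have : (finiteLength F F' A).IsClosedUnderBinaryProducts := .mk' (by
    rintro _ ⟨G, hG⟩
    refine (finiteLength F F' A).prop_of_iso ?_
      ((finiteLength F F' A).prop_biprod (hG ⟨.left⟩) (hG ⟨.right⟩))
    exact (biprod.isoProd _ _) ≪≫ (HasLimit.isoOfNatIso (diagramIsoPair G)).symm)
  .mk'

lemma isAbelian_scalarExtension : IsAbelian (ScalarExtension F F' A) := ⟨inferInstance, rfl⟩

variable {F F' A}

/-- An object of finite length still has finite length in the full subcategory of such objects. -/
lemma hasFiniteLength_scalarExtension {X : IndModule F F' A} (hX : HasFiniteLength X) :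
    HasFiniteLength (C := ScalarExtension F F' A) ⟨X, hX⟩ := by
  induction hX with
  | zero X hX =>
    refine .zero _ ?_
    rw [IsZero.iff_id_eq_zero] at hX ⊢
    exact (finiteLength F F' A).hom_ext hX
  | extend S hS h₁ h₃ ih =>
    let P := finiteLength F F' A
    have := hS.mono_f
    have := hS.epi_g
    let S' : ShortComplex (ScalarExtension F F' A) :=
      ShortComplex.mk (X₁ := ⟨S.X₁, h₁⟩) (X₂ := ⟨S.X₂, .extend S hS h₁ h₃⟩)
        (X₃ := ⟨S.X₃, HasFiniteLength.of_epi (.extend S hS h₁ h₃) S.g⟩)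
        (P.homMk S.f) (P.homMk S.g) (P.hom_ext S.zero)
    have : Mono S'.f := P.ι.mono_of_mono_map (inferInstanceAs (Mono S.f))
    have : Epi S'.g := P.ι.epi_of_epi_map (inferInstanceAs (Epi S.g))
    have hS' : S'.ShortExact :=
      { exact := ShortComplex.exact_of_f_is_kernel _ (KernelFork.IsLimit.ofι' _ _ fun k hk =>
          ⟨P.homMk (hS.exact.lift k.hom (congrArg InducedCategory.Hom.hom hk)),
            P.hom_ext (hS.exact.lift_f _ _)⟩) }
    have h3' : Simple S'.X₃ :=
      have : Simple (P.ι.obj S'.X₃) := h₃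
      have := P.preservesMonomorphisms_ι_of_isNormalEpiCategory
      P.ι.simple_of_simple_obj S'.X₃
    exact .extend S' hS' ih h3'

lemma isFFinite_scalarExtension (hA : IsFFinite F A) :
    IsFFinite F' (ScalarExtension F F' A) where
  hasFiniteLength X := hasFiniteLength_scalarExtension X.property
  finite_end X := by
    let ι := (finiteLength F F' A).ι
    have : Module.Finite F' (ι.obj X ⟶ ι.obj X) :=
      finite_hom_of_hasFiniteLength (isCompactlySeparating_toIndCat A) hA X.property X.property
    exact .of_injective (ι.mapLinearMap F' (X := X) (Y := X)) ι.map_injective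

end FullSubcategory

end ScalarExt
end

theorem mainTheorem2 (F : Type u₁) (F' : Type w) [Field F] [Field F'] [Algebra F F']
    (A : Type u) [Category.{v} A] [Abelian A] [Linear F A] (hA : ScalarExt.IsFFinite F A) :
    ScalarExt.IsAbelian (ScalarExt.ScalarExtension F F' A) ∧
    ScalarExt.IsFFinite F' (ScalarExt.ScalarExtension F F' A) ∧
    ∃ ht : ∀ X : A, ScalarExt.finiteLength F F' A ((ScalarExt.tInd F F' A).obj X),
      let t : A ⥤ ScalarExt.ScalarExtension F F' A :=
        (ScalarExt.finiteLength F F' A).lift (ScalarExt.tInd F F' A) ht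
      ∃ (_ : t.Additive) (_ : t.Linear F),
        PreservesFiniteLimits t ∧ PreservesFiniteColimits t ∧
        ScalarExt.IsRelativelyFullyFaithful F F' t := by
  have hK := ScalarExt.isCompactlySeparating_toIndCat.{w} A
  refine ⟨ScalarExt.isAbelian_scalarExtension F F' A, ScalarExt.isFFinite_scalarExtension hA,
    ScalarExt.hasFiniteLength_free hK hA, ?_⟩
  intro t
  let ι := (ScalarExt.finiteLength F F' A).ι
  have h₁ : t.Additive := ScalarExt.additive_lift _ _ _
  have h₂ : t.Linear F := ScalarExt.linear_lift _ _ _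
  -- exactness can be tested after the inclusion into the category of all modules
  have : PreservesFiniteLimits (t ⋙ ι) :=
    ScalarExt.preservesFiniteLimits_free (F := F) (F' := F') hK
  have : PreservesFiniteColimits (t ⋙ ι) :=
    comp_preservesFiniteColimits (ScalarExt.toIndCat.{w} A) (ScalarExt.freeModule F F')
  exact ⟨h₁, h₂, preservesFiniteLimits_of_reflects_of_preserves t ι,
    preservesFiniteColimits_of_reflects_of_preserves t ι,
    (ScalarExt.isRelativelyFullyFaithful_free hK).lift _ _ _⟩
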